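/- Let $p$ be a prime, $n\ge 1$ an integer, $R$ an $\mathbb F_p$-algebra and $\lambda\in R$. Let $\mathcal G^{(\lambda)}=\operatorname{Spec}R[T,\frac1{1+\lambda T}]$ be the commutative $R$-group scheme with comultiplication $T\mapsto T\otimes1+1\otimes T+\lambda\,T\otimes T$, counit $T\mapsto 0$ and antipode $T\mapsto -T/(1+\lambda T)$; let $\Gamma=\Gamma^{(\lambda)}=\operatorname{Spec}R[T]/(T^{p^n})$, with the structure given by the same formulas, let $e:\Gamma\to\mathcal G^{(\lambda)}$ be the embedding $T\mapsto T$, and let $F^n:\mathcal G^{(\lambda)}\to\mathcal G^{(\lambda^{p^n})}$ be given by $T\mapsto T^{p^n}$. Let $U(\Gamma)$ be the unit group scheme of the group algebra of $\Gamma$, representing $A\mapsto \operatorname{Hom}_R(\mathcal O(\Gamma),A)^\times$ (units for the convolution product). With respect to the basis $e_s=T^s$ $(0\le s\le p^n-1)$ of $H=\mathcal O(\Gamma)$, write $\Delta(e_t)=\sum_s e_s\otimes R_{st}$, and let $R_{st}(X)$ be the linear form obtained from $R_{st}\in H$ by replacing each $T^k$ by $X_{T^k}$; then $\mathcal O(U(\Gamma))=R[X_1,X_T,\dots,X_{T^{p^n-1}},1/\det(R_{st}(X))]$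 with $X_{T^t}\mapsto\sum_s X_{T^s}\otimes R_{st}(X)$. Let $i:\Gamma\to U(\Gamma)$ be the canonical embedding $X_{T^s}\mapsto T^s$, and let $q:U(\Gamma)\to U(\Gamma)/\Gamma$ be given by the inclusion into $\mathcal O(U(\Gamma))$ of the Hopf subalgebra $\mathcal O(U(\Gamma))^{\mathrm{co}\,\mathcal O(\Gamma)}=\{a:(\mathrm{id}\otimes i^\#)\Delta(a)=a\otimes1\}$. Then the two sequences of $R$-group schemes $$0\to\Gamma\xrightarrow{e}\mathcal G^{(\lambda)}\xrightarrow{F^n}\mathcal G^{(\lambda^{p^n})}\to0,\qquad 0\to\Gamma\xrightarrow{i}U(\Gamma)\xrightarrow{q}U(\Gamma)/\Gamma\to0$$ are exact (the first map is the kernel of the second, and the second is faithfully flat and of finite presentation), and: (1) $X_{T^s}\mapsto T^s$ $(0\le s\le p^n-1)$ defines a homomorphism of $R$-group schemes $\sigma_1:\mathcal G^{(\lambda)}\to U(\Gamma)$ with $\sigma_1\circ e=i$, and there is a unique homomorphism $\tau_1:\mathcal G^{(\lambda^{p^n})}\to U(\Gamma)/\Gamma$ with $\tau_1\circ F^n=q\circ\sigma_1$;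 (2) $X_1$ is invertible in $\mathcal O(U(\Gamma))$, $T\mapsto X_T/X_1$ defines a homomorphism of $R$-group schemes $\sigma_2:U(\Gamma)\to\mathcal G^{(\lambda)}$ with $\sigma_2\circ i=e$, and there is a unique homomorphism $\tau_2:U(\Gamma)/\Gamma\to\mathcal G^{(\lambda^{p^n})}$ with $\tau_2\circ q=F^n\circ\sigma_2$. -/

import Mathlib

universe u
open scoped TensorProduct Polynomial
open Coalgebra WithConv
noncomputable section
namespace GrothendieckResolution
section Coordinate
variable {R : Type u} [CommRing R]

/-- The coordinate ring `R[T, 1/(1 + λT)]` of `𝒢^(λ)`. -/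
def GAlg (lam : R) : Type u := Localization.Away (1 + Polynomial.C lam * Polynomial.X : R[X])

namespace GAlg
variable (lam : R)

instance : CommRing (GAlg lam) :=
  inferInstanceAs (CommRing (Localization.Away (1 + Polynomial.C lam * Polynomial.X : R[X])))

instance : Algebra R[X] (GAlg lam) :=
  inferInstanceAs (Algebra R[X] (Localization.Away (1 + Polynomial.C lam * Polynomial.X : R[X])))

instance : Algebra R (GAlg lam) :=
  inferInstanceAs (Algebra R (Localization.Away (1 + Polynomial.C lam * Polynomial.X : R[X])))

instance : IsScalarTower R R[X] (GAlg lam) :=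
  inferInstanceAs (IsScalarTower R R[X]
    (Localization.Away (1 + Polynomial.C lam * Polynomial.X : R[X])))

instance : IsLocalization.Away (1 + Polynomial.C lam * Polynomial.X : R[X]) (GAlg lam) :=
  inferInstanceAs (IsLocalization.Away _
    (Localization.Away (1 + Polynomial.C lam * Polynomial.X : R[X])))

/-- The coordinate `T`. -/
def T : GAlg lam := algebraMap R[X] (GAlg lam) Polynomial.X

variable {lam}

theorem isUnit_one_add : IsUnit (1 + algebraMap R (GAlg lam) lam * T lam) := by
  have := IsLocalization.Away.algebraMap_isUnit (S := GAlg lam)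
    (1 + Polynomial.C lam * Polynomial.X : R[X])
  simpa [T, IsScalarTower.algebraMap_apply R R[X] (GAlg lam)] using this

variable {A : Type*} [CommRing A] [Algebra R A]

/-- The algebra homomorphism `R[T, 1/(1 + λT)] → A` with `T ↦ a`. -/
def lift (a : A) (h : IsUnit (1 + algebraMap R A lam * a)) : GAlg lam →ₐ[R] A :=
  IsLocalization.Away.liftAlgHom (S := GAlg lam) (x := (1 + Polynomial.C lam * Polynomial.X : R[X]))
    (f := Polynomial.aeval a) (by simpa using h)

@[simp]
theorem lift_T (a : A) (h : IsUnit (1 + algebraMap R A lam * a)) : lift a h (T lam) = a := by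
  simp [lift, T]

theorem algHom_ext {f g : GAlg lam →ₐ[R] A} (h : f (T lam) = g (T lam)) : f = g := by
  apply IsLocalization.algHom_ext (Submonoid.powers (1 + Polynomial.C lam * Polynomial.X : R[X]))
  ext; exact h


variable (lam) in
/-- `T ↦ T ⊗ 1 + 1 ⊗ T + λ T ⊗ T`. -/
def comulAlgHom : GAlg lam →ₐ[R] GAlg lam ⊗[R] GAlg lam :=
  lift (T lam ⊗ₜ[R] 1 + 1 ⊗ₜ[R] T lam + lam • (T lam ⊗ₜ[R] T lam)) (by
    have h : (1 + algebraMap R (GAlg lam ⊗[R] GAlg lam) lam *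
        (T lam ⊗ₜ[R] 1 + 1 ⊗ₜ[R] T lam + lam • (T lam ⊗ₜ[R] T lam))) =
        Algebra.TensorProduct.includeLeft (R := R) (S := R)
            (1 + algebraMap R (GAlg lam) lam * T lam) *
          Algebra.TensorProduct.includeRight (1 + algebraMap R (GAlg lam) lam * T lam) := by
      simp only [map_add, map_mul, map_one, AlgHom.commutes, Algebra.smul_def,
        Algebra.TensorProduct.includeLeft_apply, Algebra.TensorProduct.includeRight_apply]
      rw [show T lam ⊗ₜ[R] T lam = (T lam ⊗ₜ[R] (1 : GAlg lam)) * ((1 : GAlg lam) ⊗ₜ[R] T lam) by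
        simp]
      ring
    rw [h]
    exact (isUnit_one_add.map _).mul (isUnit_one_add.map _))

variable (lam) in
/-- `T ↦ 0`. -/
def counitAlgHom : GAlg lam →ₐ[R] R := lift 0 (by simp)

variable (lam) in
/-- `T ↦ -T / (1 + λT)`. -/
def antipodeAlgHom : GAlg lam →ₐ[R] GAlg lam :=
  lift (-T lam * Ring.inverse (1 + algebraMap R (GAlg lam) lam * T lam)) (by
    refine IsUnit.of_mul_eq_one (1 + algebraMap R (GAlg lam) lam * T lam) ?_
    linear_combination (-algebraMap R (GAlg lam) lam * T lam) *
      Ring.inverse_mul_cancel _ (isUnit_one_add (lam := lam)))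

instance : Bialgebra R (GAlg lam) :=
  Bialgebra.ofAlgHom (comulAlgHom lam) (counitAlgHom lam)
    (algHom_ext (by
      simp [comulAlgHom, TensorProduct.add_tmul, TensorProduct.tmul_add, ← TensorProduct.smul_tmul',
        Algebra.TensorProduct.one_def]
      abel))
    (algHom_ext (by
      simp [comulAlgHom, counitAlgHom]))
    (algHom_ext (by
      simp [comulAlgHom, counitAlgHom]))

@[simp]
theorem comul_T : Coalgebra.comul (R := R) (T lam) =
    T lam ⊗ₜ[R] 1 + 1 ⊗ₜ[R] T lam + lam • (T lam ⊗ₜ[R] T lam) := by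
  change comulAlgHom lam (T lam) = _
  simp [comulAlgHom]

@[simp]
theorem counit_T : Coalgebra.counit (R := R) (T lam) = 0 := by
  change counitAlgHom lam (T lam) = _
  simp [counitAlgHom]

instance : HopfAlgebra R (GAlg lam) :=
  HopfAlgebra.ofAlgHom (antipodeAlgHom lam)
    (algHom_ext (by
      simp [antipodeAlgHom, Algebra.smul_def]
      linear_combination (-T lam) * Ring.inverse_mul_cancel _ (isUnit_one_add (lam := lam))))
    (algHom_ext (by
      simp [antipodeAlgHom, Algebra.smul_def]
      linear_combination (-T lam) * Ring.inverse_mul_cancel _ (isUnit_one_add (lam := lam))))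

end GAlg

theorem add_pow_prime_pow_of_algebra (p n : ℕ) [Fact p.Prime] [Algebra (ZMod p) R]
    {A : Type*} [CommRing A] [Algebra R A] (x y : A) :
    (x + y) ^ p ^ n = x ^ p ^ n + y ^ p ^ n := by
  obtain ⟨r, hr⟩ := exists_add_pow_prime_pow_eq (Fact.out : p.Prime) x y n
  have hp : (p : A) = 0 := by
    have h : algebraMap R A (algebraMap (ZMod p) R (p : ZMod p)) = 0 := by simp
    simpa only [map_natCast] using h
  rw [hr, hp]; ring

/-- The coordinate ring `R[T]/(T ^ (p ^ n))` of `Γ^(λ)`; its Hopf algebra structure depends on `λ`. -/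
def GammaAlg (p n : ℕ) (_lam : R) : Type u := AdjoinRoot (Polynomial.X ^ p ^ n : R[X])

namespace GammaAlg
variable (p n : ℕ) (lam : R)

instance : CommRing (GammaAlg p n lam) :=
  inferInstanceAs (CommRing (AdjoinRoot (Polynomial.X ^ p ^ n : R[X])))

instance : Algebra R (GammaAlg p n lam) :=
  inferInstanceAs (Algebra R (AdjoinRoot (Polynomial.X ^ p ^ n : R[X])))

/-- The coordinate `T`. -/
def T : GammaAlg p n lam := AdjoinRoot.root (Polynomial.X ^ p ^ n : R[X])

variable {p n lam}

theorem T_pow : T p n lam ^ p ^ n = 0 := by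
  change AdjoinRoot.root (Polynomial.X ^ p ^ n : R[X]) ^ p ^ n = 0
  rw [← AdjoinRoot.mk_X, ← map_pow, AdjoinRoot.mk_self]

section
variable {A : Type*} [CommRing A] [Algebra R A]

/-- The algebra homomorphism `R[T]/(T ^ (p ^ n)) → A` with `T ↦ a`. -/
def lift (a : A) (h : a ^ p ^ n = 0) : GammaAlg p n lam →ₐ[R] A :=
  AdjoinRoot.liftAlgHom (Polynomial.X ^ p ^ n : R[X]) (Algebra.ofId R A) a (by simpa using h)

@[simp]
theorem lift_T (a : A) (h : a ^ p ^ n = 0) : lift a h (T p n lam) = a :=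
  AdjoinRoot.liftAlgHom_root _ _ _ _

theorem algHom_ext {f g : GammaAlg p n lam →ₐ[R] A} (h : f (T p n lam) = g (T p n lam)) : f = g :=
  AdjoinRoot.algHom_ext h
end

theorem isUnit_one_add : IsUnit (1 + algebraMap R (GammaAlg p n lam) lam * T p n lam) :=
  IsNilpotent.isUnit_one_add ⟨p ^ n, by rw [mul_pow, T_pow, mul_zero]⟩

variable [Fact p.Prime] [Algebra (ZMod p) R]

variable (p n lam) in
/-- `T ↦ T ⊗ 1 + 1 ⊗ T + λ T ⊗ T`. -/
def comulAlgHom : GammaAlg p n lam →ₐ[R] GammaAlg p n lam ⊗[R] GammaAlg p n lam :=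
  lift (T p n lam ⊗ₜ[R] 1 + 1 ⊗ₜ[R] T p n lam + lam • (T p n lam ⊗ₜ[R] T p n lam)) (by
    have h0 : p ^ n ≠ 0 := pow_ne_zero _ (Fact.out : p.Prime).ne_zero
    simp [add_pow_prime_pow_of_algebra (R := R), T_pow, smul_pow])

variable (p n lam) in
/-- `T ↦ 0`. -/
def counitAlgHom : GammaAlg p n lam →ₐ[R] R :=
  lift 0 (by simp [(Fact.out : p.Prime).ne_zero])

variable (p n lam) in
/-- `T ↦ -T / (1 + λT)`. -/
def antipodeAlgHom : GammaAlg p n lam →ₐ[R] GammaAlg p n lam :=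
  lift (-T p n lam * Ring.inverse (1 + algebraMap R (GammaAlg p n lam) lam * T p n lam)) (by
    rw [mul_pow, neg_pow, T_pow]; simp)

instance : Bialgebra R (GammaAlg p n lam) :=
  Bialgebra.ofAlgHom (comulAlgHom p n lam) (counitAlgHom p n lam)
    (algHom_ext (by
      simp [comulAlgHom, TensorProduct.add_tmul, TensorProduct.tmul_add, ← TensorProduct.smul_tmul',
        Algebra.TensorProduct.one_def]
      abel))
    (algHom_ext (by
      simp [comulAlgHom, counitAlgHom]))
    (algHom_ext (by
      simp [comulAlgHom, counitAlgHom]))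

@[simp]
theorem comul_T : Coalgebra.comul (R := R) (T p n lam) =
    T p n lam ⊗ₜ[R] 1 + 1 ⊗ₜ[R] T p n lam + lam • (T p n lam ⊗ₜ[R] T p n lam) := by
  change comulAlgHom p n lam (T p n lam) = _
  simp [comulAlgHom]

@[simp]
theorem counit_T : Coalgebra.counit (R := R) (T p n lam) = 0 := by
  change counitAlgHom p n lam (T p n lam) = _
  simp [counitAlgHom]

instance : HopfAlgebra R (GammaAlg p n lam) :=
  HopfAlgebra.ofAlgHom (antipodeAlgHom p n lam)
    (algHom_ext (by
      simp [antipodeAlgHom, Algebra.smul_def]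
      linear_combination (-T p n lam) *
        Ring.inverse_mul_cancel _ (isUnit_one_add (p := p) (n := n) (lam := lam))))
    (algHom_ext (by
      simp [antipodeAlgHom, Algebra.smul_def]
      linear_combination (-T p n lam) *
        Ring.inverse_mul_cancel _ (isUnit_one_add (p := p) (n := n) (lam := lam))))

instance : Coalgebra.IsCocomm R (GammaAlg p n lam) where
  comm_comp_comul := by
    have h : (Algebra.TensorProduct.comm R (GammaAlg p n lam) (GammaAlg p n lam)).toAlgHom.comp
        (comulAlgHom p n lam) = comulAlgHom p n lam :=
      algHom_ext (by simp [comulAlgHom]; abel)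
    exact congr(($h).toLinearMap)

end GammaAlg

/-- The basis `1, T, …, T ^ (N - 1)` of `R[T]/(T ^ N)` (also over the zero ring). -/
def truncBasis (R : Type u) [CommRing R] (N : ℕ) :
    Module.Basis (Fin N) R (AdjoinRoot (Polynomial.X ^ N : R[X])) :=
  .ofEquivFun
    { toFun := fun f i => (AdjoinRoot.modByMonicHom (Polynomial.monic_X_pow N) f).coeff i
      map_add' := fun f g => funext fun i => by
        simp only [map_add, Polynomial.coeff_add, Pi.add_apply]
      map_smul' := fun r f => funext fun i => by
        simp only [map_smul, Polynomial.coeff_smul, Pi.smul_apply, RingHom.id_apply]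
      invFun := fun c => AdjoinRoot.mk _ (∑ i : Fin N, Polynomial.monomial i (c i))
      left_inv := fun f => AdjoinRoot.induction_on _ f fun f => Eq.symm <|
        AdjoinRoot.mk_eq_mk.mpr <| by
          simp only [AdjoinRoot.modByMonicHom_mk,
            Polynomial.sum_modByMonic_coeff (Polynomial.monic_X_pow N)
              (Polynomial.degree_X_pow_le N)]
          rw [Polynomial.modByMonic_eq_sub_mul_div, sub_sub_cancel]
          exact dvd_mul_right _ _
      right_inv := fun c => funext fun i => by
        nontriviality R
        simp only [AdjoinRoot.modByMonicHom_mk]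
        rw [(Polynomial.modByMonic_eq_self_iff (Polynomial.monic_X_pow N)).mpr,
          Polynomial.finsetSum_coeff]
        · simp_rw [Polynomial.coeff_monomial, Fin.val_eq_val]
          rw [Finset.sum_ite_eq' Finset.univ i, if_pos (Finset.mem_univ i)]
        · simp_rw [← Polynomial.C_mul_X_pow_eq_monomial]
          rw [Polynomial.degree_X_pow]
          exact Polynomial.degree_sum_fin_lt _ }

theorem truncBasis_apply (N : ℕ) (s : Fin N) :
    truncBasis R N s = AdjoinRoot.root (Polynomial.X ^ N : R[X]) ^ (s : ℕ) := by
  rw [truncBasis, Module.Basis.coe_ofEquivFun]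
  change AdjoinRoot.mk _ (∑ i : Fin N, Polynomial.monomial i
    ((Pi.single s 1 : Fin N → R) i)) = AdjoinRoot.root _ ^ (s : ℕ)
  rw [← AdjoinRoot.mk_X, ← map_pow, Finset.sum_eq_single s]
  · simp [Polynomial.X_pow_eq_monomial]
  · intro i _ hi; simp [hi]
  · simp

/-- The basis `1, T, …, T ^ (p ^ n - 1)` of the coordinate ring of `Γ^(λ)`. -/
def GammaAlg.basis (p n : ℕ) (lam : R) : Module.Basis (Fin (p ^ n)) R (GammaAlg p n lam) :=
  truncBasis R (p ^ n)

theorem GammaAlg.basis_apply (p n : ℕ) (lam : R) (s : Fin (p ^ n)) :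
    GammaAlg.basis p n lam s = GammaAlg.T p n lam ^ (s : ℕ) :=
  truncBasis_apply (p ^ n) s

end Coordinate

section UnitGroup
variable {R : Type*} [CommRing R] {H : Type*} [CommRing H] [HopfAlgebra R H]
  {ι : Type*} [Fintype ι] [DecidableEq ι] (b : Module.Basis ι R H)

/-- The elements `R_ij` of `H` defined by `Δ e_j = ∑ i, e_i ⊗ R_ij`. -/
def regCoeff (i j : ι) : H := TensorProduct.lid R H ((b.coord i).rTensor H (comul (b j)))

theorem sum_tmul_regCoeff (j : ι) : ∑ i, b i ⊗ₜ[R] regCoeff b i j = comul (b j) := by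
  have key : ∀ x : H ⊗[R] H,
      ∑ i, b i ⊗ₜ[R] (TensorProduct.lid R H ((b.coord i).rTensor H x)) = x := by
    intro x
    induction x with
    | zero => simp
    | add x y hx hy => simp only [map_add, TensorProduct.tmul_add, Finset.sum_add_distrib, hx, hy]
    | tmul x y =>
      simp only [LinearMap.rTensor_tmul, TensorProduct.lid_tmul, ← TensorProduct.smul_tmul,
        ← TensorProduct.sum_tmul, Module.Basis.coord_apply, b.sum_repr]
  exact key _

variable {A : Type*} [CommRing A] [Algebra R A]

/-- The matrix `(f (R_ij))` attached to a linear map `f : H → A`, i.e. to a point of the group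
algebra scheme `A(Γ)`, `Γ = Spec H`. -/
def regMatrix (f : H →ₗ[R] A) : Matrix ι ι A := Matrix.of fun i j => f (regCoeff b i j)

theorem convMul_basis (f g : WithConv (H →ₗ[R] A)) (j : ι) :
    (f * g) (b j) = ∑ i, f (b i) * g (regCoeff b i j) := by
  rw [LinearMap.convMul_apply, ← sum_tmul_regCoeff]
  simp

theorem comul_regCoeff (i j : ι) :
    comul (R := R) (regCoeff b i j) = ∑ k, regCoeff b i k ⊗ₜ[R] regCoeff b k j := by
  have h := Coalgebra.coassoc_apply (R := R) (b j)
  rw [← sum_tmul_regCoeff] at h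
  simp only [map_sum, LinearMap.rTensor_tmul, LinearMap.lTensor_tmul] at h
  have h2 := congr(TensorProduct.lid R (H ⊗[R] H) ((b.coord i).rTensor (H ⊗[R] H) $h))
  simp only [← sum_tmul_regCoeff, TensorProduct.sum_tmul, map_sum, TensorProduct.assoc_tmul,
    LinearMap.rTensor_tmul, TensorProduct.lid_tmul, Module.Basis.coord_apply,
    Module.Basis.repr_self, Finsupp.single_apply, ite_smul, one_smul, zero_smul,
    Finset.sum_ite_eq', Finset.mem_univ, if_true] at h2
  simpa using h2.symm

theorem counit_regCoeff (i j : ι) :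
    counit (R := R) (regCoeff b i j) = if i = j then 1 else 0 := by
  have h := Coalgebra.lTensor_counit_comul (R := R) (b j)
  rw [← sum_tmul_regCoeff] at h
  have h2 := congr(b.coord i (TensorProduct.rid R H $h))
  simpa [Finsupp.single_apply, eq_comm] using h2

theorem regMatrix_mul (f g : WithConv (H →ₗ[R] A)) :
    regMatrix b (f * g).ofConv = regMatrix b f.ofConv * regMatrix b g.ofConv := by
  ext i j
  simp [regMatrix, Matrix.mul_apply, LinearMap.convMul_def, comul_regCoeff]

theorem regMatrix_one : regMatrix b (1 : WithConv (H →ₗ[R] A)).ofConv = 1 := by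
  ext i j
  simp [regMatrix, LinearMap.convOne_def, counit_regCoeff, Matrix.one_apply]

theorem isUnit_det_regMatrix {f : WithConv (H →ₗ[R] A)} (h : IsUnit f) :
    IsUnit (regMatrix b f.ofConv).det := by
  obtain ⟨g, hg⟩ := h.exists_right_inv
  refine IsUnit.of_mul_eq_one (regMatrix b g.ofConv).det ?_
  rw [← Matrix.det_mul, ← regMatrix_mul, hg, regMatrix_one, Matrix.det_one]

theorem isUnit_of_det [IsCocomm R H] {f : H →ₗ[R] A} (h : IsUnit (regMatrix b f).det) :
    IsUnit (toConv f) := by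
  let g : H →ₗ[R] A := b.constr R fun i =>
    ∑ k, algebraMap R A (counit (b k)) * (regMatrix b f)⁻¹ k i
  refine IsUnit.of_mul_eq_one_right (toConv g) ?_
  apply WithConv.ext
  refine b.ext fun j => ?_
  change (toConv g * toConv f) (b j) = _
  rw [convMul_basis]
  have h2 : ∀ i, g (b i) = ∑ k, algebraMap R A (counit (b k)) * (regMatrix b f)⁻¹ k i := by
    intro i; simp [g]
  simp only [h2, Finset.sum_mul]
  rw [Finset.sum_comm]
  have h3 : ∀ k, ∑ i, (regMatrix b f)⁻¹ k i * f (regCoeff b i j) = (1 : Matrix ι ι A) k j := by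
    intro k
    rw [← Matrix.nonsing_inv_mul _ h, Matrix.mul_apply]
    rfl
  simp only [mul_assoc, ← Finset.mul_sum, h3, Matrix.one_apply]
  simp

end UnitGroup

section Conv
variable {R : Type*} [CommRing R] {C : Type*} [AddCommGroup C] [Module R C] [Coalgebra R C]
  {D : Type*} [AddCommGroup D] [Module R D] [Coalgebra R D]
  {A : Type*} [CommRing A] [Algebra R A] {B : Type*} [CommRing B] [Algebra R B]

/-- Composition with an algebra homomorphism, on convolution monoids. -/
def convPost (φ : A →ₐ[R] B) : WithConv (C →ₗ[R] A) →* WithConv (C →ₗ[R] B) where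
  toFun f := toConv (φ.toLinearMap ∘ₗ f.ofConv)
  map_one' := by
    apply WithConv.ext; ext x; simp [LinearMap.convOne_def]
  map_mul' f g := by
    apply WithConv.ext; exact LinearMap.algHom_comp_convMul_distrib φ f g

/-- Composition with a coalgebra homomorphism, on convolution monoids. -/
def convPre (h : D →ₗc[R] C) : WithConv (C →ₗ[R] A) →* WithConv (D →ₗ[R] A) where
  toFun f := toConv (f.ofConv ∘ₗ h.toLinearMap)
  map_one' := by
    apply WithConv.ext; ext x; simp [LinearMap.convOne_def]
  map_mul' f g := by
    apply WithConv.ext; exact LinearMap.convMul_comp_coalgHom_distrib f g h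

end Conv

section UAlg
universe v w
variable {R : Type u} [CommRing R] {H : Type v} [CommRing H] [HopfAlgebra R H]
  {ι : Type w} [Fintype ι] [DecidableEq ι] (b : Module.Basis ι R H)

/-- `det (R_ij(X))`, where the linear forms `R_ij` in the basis are evaluated at the variables. -/
def regDet : MvPolynomial ι R := (regMatrix b (b.constr R (MvPolynomial.X (R := R)))).det

/-- For `Γ = Spec H` with `H` free with basis `(e_i)`, the coordinate ring
`R[X_i, 1/det (R_ij(X))]` of the unit group scheme `U(Γ) : A ↦ Hom_R(H, A)ˣ` (the units of the
convolution algebra). -/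
def UAlg : Type (max u w) := Localization.Away (regDet b)

namespace UAlg

instance : CommRing (UAlg b) := inferInstanceAs (CommRing (Localization.Away (regDet b)))
instance : Algebra (MvPolynomial ι R) (UAlg b) :=
  inferInstanceAs (Algebra (MvPolynomial ι R) (Localization.Away (regDet b)))
instance : Algebra R (UAlg b) := inferInstanceAs (Algebra R (Localization.Away (regDet b)))
instance : IsScalarTower R (MvPolynomial ι R) (UAlg b) :=
  inferInstanceAs (IsScalarTower R (MvPolynomial ι R) (Localization.Away (regDet b)))
instance : IsLocalization.Away (regDet b) (UAlg b) :=
  inferInstanceAs (IsLocalization.Away (regDet b) (Localization.Away (regDet b)))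

/-- The coordinate `X_{e_i}`. -/
def X (i : ι) : UAlg b := algebraMap (MvPolynomial ι R) (UAlg b) (MvPolynomial.X i)

/-- The universal linear map `e_i ↦ X_{e_i}`. -/
def univ : H →ₗ[R] UAlg b := b.constr R (X b)

@[simp] theorem univ_basis (i : ι) : univ b (b i) = X b i := by simp [univ]

variable {A : Type*} [CommRing A] [Algebra R A]

theorem map_regDet (φ : MvPolynomial ι R →ₐ[R] A) :
    φ (regDet b) = (regMatrix b (b.constr R fun i => φ (MvPolynomial.X i))).det := by
  rw [regDet, AlgHom.map_det]
  congr 1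
  ext i j
  have : φ.toLinearMap ∘ₗ b.constr R (MvPolynomial.X (R := R)) =
      b.constr R fun i => φ (MvPolynomial.X i) := b.ext fun i => by simp
  exact congr($this _)

theorem isUnit_univ [IsCocomm R H] : IsUnit (toConv (univ b)) := by
  apply isUnit_of_det b
  have h := IsLocalization.Away.algebraMap_isUnit (S := UAlg b) (regDet b)
  have h2 := map_regDet b (IsScalarTower.toAlgHom R (MvPolynomial ι R) (UAlg b))
  have h3 : IsUnit (IsScalarTower.toAlgHom R (MvPolynomial ι R) (UAlg b) (regDet b)) := h
  rw [h2] at h3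
  exact h3

/-- The algebra homomorphism defined by a convolution-invertible linear map `f : H → A`. -/
def lift (f : H →ₗ[R] A) (hf : IsUnit (toConv f)) : UAlg b →ₐ[R] A :=
  IsLocalization.Away.liftAlgHom (S := UAlg b) (x := regDet b)
    (f := MvPolynomial.aeval fun i => f (b i)) (by
      rw [map_regDet]
      have : (b.constr R fun i => MvPolynomial.aeval (R := R) (fun i => f (b i)) (MvPolynomial.X i)) = f :=
        b.ext fun i => by simp
      rw [this]
      exact isUnit_det_regMatrix b hf)

@[simp]
theorem lift_X (f : H →ₗ[R] A) (hf : IsUnit (toConv f)) (i : ι) : lift b f hf (X b i) = f (b i) := by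
  simp [lift, X]

theorem lift_comp_univ (f : H →ₗ[R] A) (hf : IsUnit (toConv f)) :
    (lift b f hf).toLinearMap ∘ₗ univ b = f :=
  b.ext fun i => by simp

@[simp]
theorem lift_univ (f : H →ₗ[R] A) (hf : IsUnit (toConv f)) (h : H) : lift b f hf (univ b h) = f h :=
  congr($(lift_comp_univ b f hf) h)

variable {b} in
theorem algHom_ext {f g : UAlg b →ₐ[R] A}
    (h : f.toLinearMap ∘ₗ univ b = g.toLinearMap ∘ₗ univ b) : f = g := by
  apply IsLocalization.algHom_ext (Submonoid.powers (regDet b))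
  ext i
  have := congr($h (b i))
  simp only [LinearMap.comp_apply, univ_basis] at this
  exact this

variable [IsCocomm R H]

theorem isUnit_comul : IsUnit (toConv (TensorProduct.map (univ b) (univ b) ∘ₗ comul (R := R))) := by
  have h : toConv (TensorProduct.map (univ b) (univ b) ∘ₗ comul (R := R)) =
      convPost (Algebra.TensorProduct.includeLeft (R := R) (S := R)) (toConv (univ b)) *
      convPost (Algebra.TensorProduct.includeRight) (toConv (univ b)) := by
    apply WithConv.ext
    ext x
    simp only [LinearMap.convMul_def, LinearMap.comp_apply]
    generalize comul (R := R) x = y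
    induction y with
    | zero => simp
    | add y z hy hz => simp only [map_add, hy, hz]
    | tmul y z => simp [convPost]
  rw [h]
  exact ((isUnit_univ b).map _).mul ((isUnit_univ b).map _)

/-- `X_{e_j} ↦ ∑ i, X_{e_i} ⊗ R_ij(X)`. -/
def comulAlgHom : UAlg b →ₐ[R] UAlg b ⊗[R] UAlg b :=
  lift b (TensorProduct.map (univ b) (univ b) ∘ₗ comul) (isUnit_comul b)

/-- `X_{e_i} ↦ ε(e_i)`. -/
def counitAlgHom : UAlg b →ₐ[R] R :=
  lift b counit (by
    have : toConv (counit (R := R) (A := H)) = 1 := rfl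
    rw [this]; exact isUnit_one)

/-- The antipode, given by the convolution inverse of the universal linear map. -/
def antipodeAlgHom : UAlg b →ₐ[R] UAlg b :=
  lift b (Ring.inverse (toConv (univ b))).ofConv (by
    rw [toConv_ofConv]; exact (isUnit_univ b).ringInverse)

theorem comulAlgHom_univ (h : H) :
    comulAlgHom b (univ b h) = TensorProduct.map (univ b) (univ b) (comul h) :=
  congr($(lift_comp_univ b _ (isUnit_comul b)) h)

theorem counitAlgHom_univ (h : H) : counitAlgHom b (univ b h) = counit h := by
  simp [counitAlgHom]

instance : Bialgebra R (UAlg b) :=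
  Bialgebra.ofAlgHom (comulAlgHom b) (counitAlgHom b)
    (algHom_ext (by
      ext x
      change TensorProduct.assoc R _ _ _ (Algebra.TensorProduct.map (comulAlgHom b)
        (.id R (UAlg b)) (comulAlgHom b (univ b x))) = Algebra.TensorProduct.map
        (.id R (UAlg b)) (comulAlgHom b) (comulAlgHom b (univ b x))
      rw [comulAlgHom_univ]
      have hc := congr(TensorProduct.map (univ b) (TensorProduct.map (univ b) (univ b))
        $(Coalgebra.coassoc_apply (R := R) x))
      refine Eq.trans ?_ (hc.trans ?_)
      · generalize comul (R := R) x = y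
        induction y with
        | zero => simp
        | add y z hy hz => simp only [map_add, hy, hz]
        | tmul y z =>
          simp only [TensorProduct.map_tmul, Algebra.TensorProduct.map_tmul, comulAlgHom_univ,
            LinearMap.rTensor_tmul]
          generalize comul (R := R) y = t
          induction t with
          | zero => simp
          | add t s ht hs => simp only [map_add, TensorProduct.add_tmul, ht, hs]
          | tmul t s => simp
      · generalize comul (R := R) x = y
        induction y with
        | zero => simp
        | add y z hy hz => simp only [map_add, hy, hz]
        | tmul y z => simp [comulAlgHom_univ]))
    (algHom_ext (by
      ext x
      change Algebra.TensorProduct.map (counitAlgHom b) (.id R (UAlg b))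
        (comulAlgHom b (univ b x)) = 1 ⊗ₜ univ b x
      have h := congr(TensorProduct.map LinearMap.id (univ b)
        $(Coalgebra.rTensor_counit_comul (R := R) x))
      rw [comulAlgHom_univ]
      refine Eq.trans ?_ h
      generalize comul (R := R) x = y
      induction y with
      | zero => simp
      | add y z hy hz => simp only [map_add, hy, hz]
      | tmul y z => simp [counitAlgHom_univ]))
    (algHom_ext (by
      ext x
      change Algebra.TensorProduct.map (.id R (UAlg b)) (counitAlgHom b)
        (comulAlgHom b (univ b x)) = univ b x ⊗ₜ 1
      have h := congr(TensorProduct.map (univ b) LinearMap.id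
        $(Coalgebra.lTensor_counit_comul (R := R) x))
      rw [comulAlgHom_univ]
      refine Eq.trans ?_ h
      generalize comul (R := R) x = y
      induction y with
      | zero => simp
      | add y z hy hz => simp only [map_add, hy, hz]
      | tmul y z => simp [counitAlgHom_univ]))

theorem comul_univ (h : H) : comul (R := R) (univ b h) =
    TensorProduct.map (univ b) (univ b) (comul h) := comulAlgHom_univ b h

theorem counit_univ (h : H) : counit (R := R) (univ b h) = counit h :=
  counitAlgHom_univ b h

theorem lift_comp_comul (f g : UAlg b →ₐ[R] A) :
    toConv (((Algebra.TensorProduct.lift f g fun _ _ => Commute.all _ _).comp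
      (Bialgebra.comulAlgHom R (UAlg b))).toLinearMap ∘ₗ univ b) =
    toConv (f.toLinearMap ∘ₗ univ b) * toConv (g.toLinearMap ∘ₗ univ b) := by
  apply WithConv.ext
  ext x
  simp only [LinearMap.convMul_def, LinearMap.comp_apply, AlgHom.toLinearMap_apply,
    AlgHom.comp_apply, Bialgebra.comulAlgHom_apply, comul_univ]
  generalize comul (R := R) x = y
  induction y with
  | zero => simp
  | add y z hy hz => simp only [map_add, hy, hz]
  | tmul y z => simp

theorem ofId_comp_counit : toConv (((Algebra.ofId R A).comp
    (Bialgebra.counitAlgHom R (UAlg b))).toLinearMap ∘ₗ univ b) = 1 := by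
  apply WithConv.ext
  ext x
  simp [LinearMap.convOne_def, counit_univ, Algebra.ofId_apply]

instance : HopfAlgebra R (UAlg b) :=
  HopfAlgebra.ofAlgHom (antipodeAlgHom b)
    (algHom_ext (toConv_injective (by
      rw [lift_comp_comul, ofId_comp_counit, antipodeAlgHom, lift_comp_univ, toConv_ofConv]
      exact Ring.inverse_mul_cancel _ (isUnit_univ b))))
    (algHom_ext (toConv_injective (by
      rw [lift_comp_comul, ofId_comp_counit, antipodeAlgHom, lift_comp_univ, toConv_ofConv]
      exact Ring.mul_inverse_cancel _ (isUnit_univ b))))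

instance : IsCocomm R (UAlg b) where
  comm_comp_comul := by
    have h : (Algebra.TensorProduct.comm R (UAlg b) (UAlg b)).toAlgHom.comp
        (comulAlgHom b) = comulAlgHom b :=
      algHom_ext (by
        ext x
        change TensorProduct.comm R (UAlg b) (UAlg b) (comulAlgHom b (univ b x)) =
          comulAlgHom b (univ b x)
        simp only [comulAlgHom, lift_univ, LinearMap.comp_apply]
        rw [← TensorProduct.map_comm, Coalgebra.comm_comul])
    exact congr(($h).toLinearMap)

theorem isUnit_id : IsUnit (toConv (LinearMap.id (R := R) (M := H))) :=
  IsUnit.of_mul_eq_one (toConv (HopfAlgebra.antipode R)) LinearMap.id_mul_antipode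

/-- The Hopf algebra map `X_{e_i} ↦ e_i` of the canonical embedding `Γ → U(Γ)`. -/
def toGroup : UAlg b →ₐc[R] H :=
  .ofAlgHom (lift b LinearMap.id isUnit_id)
    (algHom_ext (by
      ext x
      simp [counit_univ]))
    (algHom_ext (by
      ext x
      simp only [LinearMap.comp_apply, AlgHom.toLinearMap_apply,
        AlgHom.comp_apply, Bialgebra.comulAlgHom_apply, comul_univ, lift_univ, LinearMap.id_apply]
      generalize comul (R := R) x = y
      induction y with
      | zero => simp
      | add y z hy hz => simp only [map_add, hy, hz]
      | tmul y z => simp))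

@[simp] theorem toGroup_univ (h : H) : toGroup b (univ b h) = h :=
  lift_univ b LinearMap.id isUnit_id h
end UAlg
end UAlg


section SubHopf
variable {R : Type*} [CommRing R] {A : Type*} [CommRing A] [HopfAlgebra R A] (C : Subalgebra R A)
  (h₂ : Function.Injective (Algebra.TensorProduct.map C.val C.val))
  (hΔ : ∀ c : C, comul (R := R) (c : A) ∈ (Algebra.TensorProduct.map C.val C.val).range)
  (hS : ∀ c : C, HopfAlgebra.antipode R (c : A) ∈ C)

/-- The comultiplication of `A` restricted to `C`. -/
def subComul : C →ₐ[R] C ⊗[R] C :=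
  (AlgEquiv.ofInjective (Algebra.TensorProduct.map C.val C.val) h₂).symm.toAlgHom.comp
    (((Bialgebra.comulAlgHom R A).comp C.val).codRestrict _ hΔ)

theorem map_subComul (c : C) :
    Algebra.TensorProduct.map C.val C.val (subComul C h₂ hΔ c) = comul (R := R) (c : A) := by
  have h := (AlgEquiv.ofInjective (Algebra.TensorProduct.map C.val C.val) h₂).apply_symm_apply
    (((Bialgebra.comulAlgHom R A).comp C.val).codRestrict _ hΔ c)
  exact congr(Subtype.val $h)

theorem subComul_coassoc
    (h₃ : Function.Injective
      (Algebra.TensorProduct.map C.val (Algebra.TensorProduct.map C.val C.val))) (c : C) :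
    Algebra.TensorProduct.assoc R R R C C C (Algebra.TensorProduct.map (subComul C h₂ hΔ)
      (.id R C) (subComul C h₂ hΔ c)) =
    Algebra.TensorProduct.map (.id R C) (subComul C h₂ hΔ) (subComul C h₂ hΔ c) := by
  apply h₃
  have hc := Coalgebra.coassoc_apply (R := R) (c : A)
  rw [← map_subComul C h₂ hΔ] at hc
  refine Eq.trans ?_ (hc.trans ?_)
  · generalize subComul C h₂ hΔ c = y
    induction y with
    | zero => simp
    | add y z hy hz => simp only [map_add, hy, hz]
    | tmul y z =>
      simp only [Algebra.TensorProduct.map_tmul, LinearMap.rTensor_tmul, Subalgebra.coe_val,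
        ← map_subComul C h₂ hΔ, AlgHom.coe_id, id_eq]
      generalize subComul C h₂ hΔ y = t
      induction t with
      | zero => simp
      | add t s ht hs => simp only [map_add, TensorProduct.add_tmul, ht, hs]
      | tmul t s => simp
  · generalize subComul C h₂ hΔ c = y
    induction y with
    | zero => simp
    | add y z hy hz => simp only [map_add, hy, hz]
    | tmul y z => simp [map_subComul]

variable (h₃ : Function.Injective
    (Algebra.TensorProduct.map C.val (Algebra.TensorProduct.map C.val C.val)))

/-- A subalgebra stable under the structure maps, as a bialgebra. -/
abbrev subBialgebra : Bialgebra R C :=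
  Bialgebra.ofAlgHom (subComul C h₂ hΔ) ((Bialgebra.counitAlgHom R A).comp C.val)
    (AlgHom.ext fun c => subComul_coassoc C h₂ hΔ h₃ c)
    (AlgHom.ext fun c => by
      have h := Coalgebra.rTensor_counit_comul (R := R) (c : A)
      rw [← map_subComul C h₂ hΔ] at h
      have h' := congr(TensorProduct.lid R A $h)
      apply (TensorProduct.lid R C).injective
      apply Subtype.val_injective
      refine Eq.trans ?_ (h'.trans ?_)
      · simp only [AlgHom.comp_apply]
        generalize subComul C h₂ hΔ c = y
        induction y with
        | zero => simp
        | add y z hy hz => simp only [map_add, Subalgebra.coe_add, hy, hz]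
        | tmul y z => simp
      · simp)
    (AlgHom.ext fun c => by
      have h := Coalgebra.lTensor_counit_comul (R := R) (c : A)
      rw [← map_subComul C h₂ hΔ] at h
      have h' := congr(TensorProduct.rid R A $h)
      apply (TensorProduct.rid R C).injective
      apply Subtype.val_injective
      refine Eq.trans ?_ (h'.trans ?_)
      · simp only [AlgHom.comp_apply]
        generalize subComul C h₂ hΔ c = y
        induction y with
        | zero => simp
        | add y z hy hz => simp only [map_add, Subalgebra.coe_add, hy, hz]
        | tmul y z => simp
      · simp)

/-- A subalgebra stable under the structure maps, as a Hopf algebra. -/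
abbrev subHopf : HopfAlgebra R C :=
  letI := subBialgebra C h₂ hΔ h₃
  HopfAlgebra.ofAlgHom (((HopfAlgebra.antipodeAlgHom R A).comp C.val).codRestrict C hS)
    (AlgHom.ext fun c => by
      have h := HopfAlgebra.mul_antipode_rTensor_comul_apply (R := R) (c : A)
      rw [← map_subComul C h₂ hΔ] at h
      apply Subtype.val_injective
      refine Eq.trans ?_ (h.trans ?_)
      · change ((Algebra.TensorProduct.lift _ _ (fun _ _ => Commute.all _ _)
          (subComul C h₂ hΔ c) : C) : A) = _
        generalize subComul C h₂ hΔ c = y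
        induction y with
        | zero => simp
        | add y z hy hz => simp only [map_add, Subalgebra.coe_add, hy, hz]
        | tmul y z => simp; rfl
      · rfl)
    (AlgHom.ext fun c => by
      have h := HopfAlgebra.mul_antipode_lTensor_comul_apply (R := R) (c : A)
      rw [← map_subComul C h₂ hΔ] at h
      apply Subtype.val_injective
      refine Eq.trans ?_ (h.trans ?_)
      · change ((Algebra.TensorProduct.lift _ _ (fun _ _ => Commute.all _ _)
          (subComul C h₂ hΔ c) : C) : A) = _
        generalize subComul C h₂ hΔ c = y
        induction y with
        | zero => simp
        | add y z hy hz => simp only [map_add, Subalgebra.coe_add, hy, hz]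
        | tmul y z => simp; rfl
      · rfl)

end SubHopf

section Coinvariants
variable {R : Type*} [CommRing R] {A : Type*} [CommRing A] [HopfAlgebra R A]
  {H : Type*} [CommRing H] [HopfAlgebra R H] (π : A →ₐc[R] H)

/-- The right coaction `(id ⊗ π) ∘ Δ` of `H` on `A`. -/
def coaction : A →ₐ[R] A ⊗[R] H :=
  (Algebra.TensorProduct.map (.id R A) (π : A →ₐ[R] H)).comp (Bialgebra.comulAlgHom R A)

/-- The subalgebra `A^{co H}` of all `a` with `(id ⊗ π)(Δ a) = a ⊗ 1`. -/
def coinvariants : Subalgebra R A :=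
  AlgHom.equalizer (coaction π) Algebra.TensorProduct.includeLeft

theorem mem_coinvariants {a : A} : a ∈ coinvariants π ↔ coaction π a = a ⊗ₜ 1 := Iff.rfl

theorem conv_apply_coinvariant {B : Type*} [CommRing B] [Algebra R B] (f : A →ₗ[R] B)
    (g : WithConv (H →ₗ[R] B)) {c : A} (hc : c ∈ coinvariants π) :
    (toConv f * convPre (π : A →ₗc[R] H) g).ofConv c = f c * g.ofConv 1 := by
  have h : (toConv f * convPre (π : A →ₗc[R] H) g).ofConv c =
      LinearMap.mul' R B (TensorProduct.map f g.ofConv (coaction π c)) := by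
    simp only [LinearMap.convMul_def, LinearMap.comp_apply, coaction, AlgHom.comp_apply,
      Bialgebra.comulAlgHom_apply]
    generalize comul (R := R) c = y
    induction y with
    | zero => simp
    | add y z hy hz => simp only [map_add, hy, hz]
    | tmul y z => simp [convPre]
  rw [h, (mem_coinvariants π).1 hc]
  simp

theorem coaction_eq : toConv (coaction π).toLinearMap =
    convPost (Algebra.TensorProduct.includeLeft (R := R) (S := R)) (toConv LinearMap.id) *
    convPre (π : A →ₗc[R] H)
      (toConv (Algebra.TensorProduct.includeRight (R := R) (A := A) (B := H)).toLinearMap) := by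
  apply WithConv.ext
  ext x
  simp only [LinearMap.convMul_def, LinearMap.comp_apply, coaction, AlgHom.comp_apply,
      Bialgebra.comulAlgHom_apply, AlgHom.toLinearMap_apply]
  generalize comul (R := R) x = y
  induction y with
  | zero => simp
  | add y z hy hz => simp only [map_add, hy, hz]
  | tmul y z => simp [convPre, convPost]

theorem comul_eq : toConv (comul (R := R) (A := A)) =
    convPost (Algebra.TensorProduct.includeLeft (R := R) (S := R)) (toConv LinearMap.id) *
    convPost (Algebra.TensorProduct.includeRight (R := R)) (toConv LinearMap.id) := by
  apply WithConv.ext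
  ext x
  simp only [LinearMap.convMul_def, LinearMap.comp_apply]
  generalize comul (R := R) x = y
  induction y with
  | zero => simp
  | add y z hy hz => rw [map_add, map_add, ← hy, ← hz]
  | tmul y z =>
    exact (by simp : y ⊗ₜ[R] z = (y ⊗ₜ[R] (1 : A)) * ((1 : A) ⊗ₜ[R] z))

end Coinvariants


section Quotient
variable {R : Type u} [CommRing R] {H : Type*} [CommRing H] [HopfAlgebra R H] [IsCocomm R H]
  {ι : Type*} [Fintype ι] [DecidableEq ι] (b : Module.Basis ι R H)

namespace UAlg

/-- The convolution inverse of the universal linear map. -/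
def univInv : WithConv (H →ₗ[R] UAlg b) := Ring.inverse (toConv (univ b))

theorem univ_mul_univInv : toConv (univ b) * univInv b = 1 :=
  Ring.mul_inverse_cancel _ (isUnit_univ b)

theorem univ_one_mul : univ b 1 * (univInv b).ofConv 1 = 1 := by
  have h := congr(($(univ_mul_univInv b)).ofConv 1)
  simpa [LinearMap.convMul_def, LinearMap.convOne_def, Algebra.TensorProduct.one_def] using h

/-- The map `a ↦ ∑ a₀ ψ⁻¹(a₁)`, with `ψ` the universal linear map. -/
def proj : WithConv (UAlg b →ₗ[R] UAlg b) :=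
  toConv LinearMap.id * convPre (toGroup b : UAlg b →ₗc[R] H) (univInv b)

theorem coaction_univ : toConv ((coaction (toGroup b)).toLinearMap ∘ₗ univ b) =
    convPost (Algebra.TensorProduct.includeLeft (R := R) (S := R)) (toConv (univ b)) *
    toConv (Algebra.TensorProduct.includeRight (R := R) (A := UAlg b) (B := H)).toLinearMap := by
  apply WithConv.ext
  ext x
  simp only [LinearMap.convMul_def, LinearMap.comp_apply, coaction, AlgHom.comp_apply,
      Bialgebra.comulAlgHom_apply, AlgHom.toLinearMap_apply, comul_univ]
  generalize comul (R := R) x = y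
  induction y with
  | zero => simp
  | add y z hy hz => simp only [map_add, hy, hz]
  | tmul y z => simp [convPost]

theorem proj_mem (a : UAlg b) : (proj b).ofConv a ∈ coinvariants (toGroup b) := by
  rw [mem_coinvariants]
  let π : UAlg b →ₗc[R] H := (toGroup b : UAlg b →ₗc[R] H)
  let L := Algebra.TensorProduct.includeLeft (R := R) (S := R) (A := UAlg b) (B := H)
  let y := convPre (A := UAlg b ⊗[R] H) π
    (toConv (Algebra.TensorProduct.includeRight (R := R) (A := UAlg b) (B := H)).toLinearMap)
  let w := convPre π (toConv (univ b))
  let w' := convPre π (univInv b)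
  have hw : w * w' = 1 := by
    simp only [w, w', ← map_mul, univ_mul_univInv, map_one]
  have h1 : convPost (coaction (toGroup b)) w * convPost (coaction (toGroup b)) w' = 1 := by
    rw [← map_mul, hw, map_one]
  have h2 : convPost L w * convPost L w' = 1 := by
    rw [← map_mul, hw, map_one]
  have h3 : convPost (coaction (toGroup b)) w = convPost L w * y := by
    have := congr(convPre π $(coaction_univ b))
    rw [map_mul] at this
    exact this
  have h4 : convPost (coaction (toGroup b)) (toConv LinearMap.id) =
      convPost L (toConv LinearMap.id) * y := coaction_eq (toGroup b)
  have h5 : convPost (coaction (toGroup b)) (proj b) = convPost L (proj b) := by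
    change convPost _ (toConv LinearMap.id * w') = convPost _ (toConv LinearMap.id * w')
    rw [map_mul, map_mul, h4]
    rw [h3] at h1
    have h6 : y * convPost (coaction (toGroup b)) w' = convPost L w' := by
      linear_combination convPost L w' * h1 - y * convPost (coaction (toGroup b)) w' * h2
    rw [mul_assoc, h6]
  exact congr(($h5).ofConv a)

theorem proj_coinvariant {c : UAlg b} (hc : c ∈ coinvariants (toGroup b)) :
    (proj b).ofConv c = c * (univInv b).ofConv 1 :=
  conv_apply_coinvariant (toGroup b) LinearMap.id (univInv b) hc

theorem univ_one_mem : univ b 1 ∈ coinvariants (toGroup b) := by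
  rw [mem_coinvariants]
  simp [coaction, comul_univ, Algebra.TensorProduct.one_def]

/-- A linear retraction of `U(Γ)`-functions onto the coinvariants. -/
def retract : UAlg b →ₗ[R] coinvariants (toGroup b) :=
  LinearMap.codRestrict (coinvariants (toGroup b)).toSubmodule
    (LinearMap.mulLeft R (univ b 1) ∘ₗ (proj b).ofConv)
    fun a => (coinvariants (toGroup b)).mul_mem (univ_one_mem b) (proj_mem b a)

theorem coe_retract (a : UAlg b) : (retract b a : UAlg b) = univ b 1 * (proj b).ofConv a := rfl

theorem retract_coe (c : coinvariants (toGroup b)) : retract b c = c := by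
  apply Subtype.val_injective
  rw [coe_retract, proj_coinvariant b c.2]
  linear_combination (c : UAlg b) * univ_one_mul b

theorem retract_comp_val :
    retract b ∘ₗ (coinvariants (toGroup b)).val.toLinearMap = LinearMap.id :=
  LinearMap.ext fun c => retract_coe b c

theorem coinv_inj₂ : Function.Injective (Algebra.TensorProduct.map
    (coinvariants (toGroup b)).val (coinvariants (toGroup b)).val) := by
  refine Function.LeftInverse.injective
    (g := TensorProduct.map (retract b) (retract b)) fun x => ?_
  have : TensorProduct.map (retract b) (retract b) ∘ₗ TensorProduct.map
      (coinvariants (toGroup b)).val.toLinearMap (coinvariants (toGroup b)).val.toLinearMap =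
      LinearMap.id := by
    rw [← TensorProduct.map_comp, retract_comp_val, TensorProduct.map_id]
  exact congr($this x)

theorem coinv_inj₃ : Function.Injective (Algebra.TensorProduct.map (coinvariants (toGroup b)).val
    (Algebra.TensorProduct.map (coinvariants (toGroup b)).val (coinvariants (toGroup b)).val)) := by
  refine Function.LeftInverse.injective
    (g := TensorProduct.map (retract b) (TensorProduct.map (retract b) (retract b))) fun x => ?_
  have : TensorProduct.map (retract b) (TensorProduct.map (retract b) (retract b)) ∘ₗ
      TensorProduct.map (coinvariants (toGroup b)).val.toLinearMap
      (TensorProduct.map (coinvariants (toGroup b)).val.toLinearMap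
        (coinvariants (toGroup b)).val.toLinearMap) = LinearMap.id := by
    rw [← TensorProduct.map_comp, ← TensorProduct.map_comp, retract_comp_val,
      TensorProduct.map_id, TensorProduct.map_id]
  exact congr($this x)

theorem comul_left (c : coinvariants (toGroup b)) :
    TensorProduct.map ((coinvariants (toGroup b)).val.toLinearMap ∘ₗ retract b) LinearMap.id
      (comul (R := R) (c : UAlg b)) = comul (R := R) (c : UAlg b) := by
  let L := Algebra.TensorProduct.includeLeft (R := R) (S := R) (A := UAlg b) (B := UAlg b)
  have h : (toConv (comul (R := R) (A := UAlg b)) *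
      convPre (toGroup b : UAlg b →ₗc[R] H) (convPost L (univInv b))).ofConv c =
      comul (R := R) (c : UAlg b) * ((univInv b).ofConv 1 ⊗ₜ 1) :=
    conv_apply_coinvariant (toGroup b) _ _ c.2
  have h2 : toConv (comul (R := R) (A := UAlg b)) *
      convPre (toGroup b : UAlg b →ₗc[R] H) (convPost L (univInv b)) =
      convPost L (proj b) *
        convPost (Algebra.TensorProduct.includeRight (R := R)) (toConv LinearMap.id) := by
    rw [comul_eq, mul_right_comm]
    congr 1
    rw [proj, map_mul]
    rfl
  rw [h2] at h
  have h3 : TensorProduct.map ((coinvariants (toGroup b)).val.toLinearMap ∘ₗ retract b)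
      LinearMap.id (comul (R := R) (c : UAlg b)) = (univ b 1 ⊗ₜ 1) * (convPost L (proj b) *
        convPost (Algebra.TensorProduct.includeRight (R := R)) (toConv LinearMap.id)).ofConv c := by
    simp only [LinearMap.convMul_def, LinearMap.comp_apply]
    generalize comul (R := R) (c : UAlg b) = y
    induction y with
    | zero => simp
    | add y z hy hz => simp only [map_add, hy, hz, mul_add]
    | tmul y z => simp [convPost, coe_retract, L]
  rw [h3, h]
  have h4 : (univ b 1 ⊗ₜ[R] (1 : UAlg b)) * ((univInv b).ofConv 1 ⊗ₜ[R] (1 : UAlg b)) = 1 := by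
    rw [Algebra.TensorProduct.tmul_mul_tmul, univ_one_mul, one_mul, Algebra.TensorProduct.one_def]
  linear_combination comul (R := R) (c : UAlg b) * h4

theorem comul_right (c : coinvariants (toGroup b)) :
    TensorProduct.map LinearMap.id ((coinvariants (toGroup b)).val.toLinearMap ∘ₗ retract b)
      (comul (R := R) (c : UAlg b)) = comul (R := R) (c : UAlg b) := by
  have h := congr(TensorProduct.comm R _ _ $(comul_left b c))
  rwa [← TensorProduct.map_comm, Coalgebra.comm_comul] at h

theorem coinv_comul (c : coinvariants (toGroup b)) :
    comul (R := R) (c : UAlg b) ∈ (Algebra.TensorProduct.map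
      (coinvariants (toGroup b)).val (coinvariants (toGroup b)).val).range := by
  refine ⟨TensorProduct.map (retract b) (retract b) (comul (R := R) (c : UAlg b)), ?_⟩
  have h : TensorProduct.map LinearMap.id ((coinvariants (toGroup b)).val.toLinearMap ∘ₗ retract b)
      (TensorProduct.map ((coinvariants (toGroup b)).val.toLinearMap ∘ₗ retract b) LinearMap.id
      (comul (R := R) (c : UAlg b))) = comul (R := R) (c : UAlg b) := by
    rw [comul_left, comul_right]
  rw [← LinearMap.comp_apply, ← TensorProduct.map_comp, LinearMap.id_comp, LinearMap.comp_id,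
    TensorProduct.map_comp] at h
  exact h

theorem coinv_antipode (c : coinvariants (toGroup b)) :
    HopfAlgebra.antipode R (c : UAlg b) ∈ coinvariants (toGroup b) := by
  rw [mem_coinvariants]
  let π : UAlg b →ₗc[R] H := (toGroup b : UAlg b →ₗc[R] H)
  let L := Algebra.TensorProduct.includeLeft (R := R) (S := R) (A := UAlg b) (B := H)
  let Rr := Algebra.TensorProduct.includeRight (R := R) (A := UAlg b) (B := H)
  let x := convPost L (toConv (LinearMap.id (R := R) (M := UAlg b)))
  let x' := convPost L (toConv (HopfAlgebra.antipode R (A := UAlg b)))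
  let y := convPre π (convPost Rr (toConv (LinearMap.id (R := R) (M := H))))
  let y' := convPre π (convPost Rr (toConv (HopfAlgebra.antipode R (A := H))))
  let z := convPost (coaction (toGroup b)) (toConv (LinearMap.id (R := R) (M := UAlg b)))
  let z' := convPost (coaction (toGroup b)) (toConv (HopfAlgebra.antipode R (A := UAlg b)))
  have hx : x * x' = 1 := by
    simp only [x, x', ← map_mul, LinearMap.id_mul_antipode, map_one]
  have hy : y * y' = 1 := by
    simp only [y, y', ← map_mul, LinearMap.id_mul_antipode, map_one]
  have hz : z * z' = 1 := by
    simp only [z, z', ← map_mul, LinearMap.id_mul_antipode, map_one]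
  have hxy : z = x * y := coaction_eq (toGroup b)
  have h : z' = x' * y' := by
    rw [hxy] at hz
    linear_combination x' * y' * hz - z' * x * x' * hy - z' * hx
  have h2 := conv_apply_coinvariant (toGroup b) x'.ofConv
    (convPost Rr (toConv (HopfAlgebra.antipode R (A := H)))) c.2
  have h3 : z'.ofConv (c : UAlg b) = x'.ofConv c * (convPost Rr (toConv
    (HopfAlgebra.antipode R (A := H)))).ofConv 1 := by rw [h]; exact h2
  refine h3.trans ?_
  simp [x', convPost, L, Rr]

end UAlg

/-- The coordinate ring of `U(Γ)/Γ`: the coinvariants of the coordinate ring of `U(Γ)` under the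
coaction defined by the embedding `Γ → U(Γ)`. Its Hopf algebra structure is the restricted one. -/
abbrev QAlg : Type _ := coinvariants (UAlg.toGroup b)

namespace QAlg

instance : HopfAlgebra R (QAlg b) :=
  subHopf (coinvariants (UAlg.toGroup b)) (UAlg.coinv_inj₂ b) (UAlg.coinv_comul b)
    (UAlg.coinv_antipode b) (UAlg.coinv_inj₃ b)

/-- The inclusion of the coinvariants, i.e. the quotient map `U(Γ) → U(Γ)/Γ`. -/
def incl : QAlg b →ₐc[R] UAlg b :=
  .ofAlgHom (coinvariants (UAlg.toGroup b)).val rfl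
    (AlgHom.ext fun c => map_subComul _ (UAlg.coinv_inj₂ b) (UAlg.coinv_comul b) c)

end QAlg
end Quotient

section GammaSpecific
variable {R : Type u} [CommRing R] (p n : ℕ) [Fact p.Prime] [Algebra (ZMod p) R] (lam : R)

/-- The Hopf algebra map `T ↦ T` of the embedding `Γ^(λ) → 𝒢^(λ)`. -/
def GAlg.toGamma : GAlg lam →ₐc[R] GammaAlg p n lam :=
  .ofAlgHom (GAlg.lift (GammaAlg.T p n lam) GammaAlg.isUnit_one_add)
    (GAlg.algHom_ext (by simp))
    (GAlg.algHom_ext (by simp))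

/-- The Hopf algebra map `T ↦ T ^ (p ^ n)` of `F^n : 𝒢^(λ) → 𝒢^(λ ^ (p ^ n))`. -/
def GAlg.frob : GAlg (lam ^ p ^ n) →ₐc[R] GAlg lam :=
  .ofAlgHom
    (GAlg.lift (GAlg.T lam ^ p ^ n) (by
      have h := (GAlg.isUnit_one_add (lam := lam)).pow (p ^ n)
      rwa [add_pow_prime_pow_of_algebra (R := R), one_pow, mul_pow, ← map_pow] at h))
    (GAlg.algHom_ext (by simp [(Fact.out : p.Prime).ne_zero]))
    (GAlg.algHom_ext (by
      simp [add_pow_prime_pow_of_algebra (R := R), smul_pow]))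

/-- The coordinate ring of `U(Γ^(λ))`, formed with the basis `1, T, …, T ^ (p ^ n - 1)`. -/
abbrev UGammaAlg : Type u := UAlg (GammaAlg.basis p n lam)

/-- The coordinate `X_{T ^ s}` of `U(Γ^(λ))`. -/
abbrev UGammaAlg.X (s : Fin (p ^ n)) : UGammaAlg p n lam := UAlg.X (GammaAlg.basis p n lam) s

/-- The coordinate ring of `U(Γ^(λ))/Γ^(λ)`. -/
abbrev UModGammaAlg : Type u := QAlg (GammaAlg.basis p n lam)

end GammaSpecific

section GroupSchemes
open CategoryTheory AlgebraicGeometry MonoidalCategory CartesianMonoidalCategory MonObj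

/-- Exactness (for the fppf topology) of a sequence `0 → G₁ → G₂ → G₃ → 0` of group schemes:
the first map is the kernel of the second one, and the second one is faithfully flat and locally
of finite presentation. -/
structure ShortExact {S : Scheme.{u}} {G₁ G₂ G₃ : Grp (Over S)} (f : G₁ ⟶ G₂) (g : G₂ ⟶ G₃) :
    Prop where
  isKernel : IsPullback f.hom.hom (toUnit G₁.X) g.hom.hom η[G₃.X]
  flat : Flat g.hom.hom.left
  surjective : Surjective g.hom.hom.left
  locallyOfFinitePresentation : LocallyOfFinitePresentation g.hom.hom.left

variable (R : Type u) [CommRing R]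

/-- Group schemes over `R`. -/
abbrev GroupScheme := Grp (Over (Spec (CommRingCat.of R)))

/-- The affine group scheme of a commutative Hopf algebra. -/
abbrev specGrp (A : Type u) [CommRing A] [HopfAlgebra R A] : GroupScheme R :=
  (hopfSpec (CommRingCat.of R)).obj (.op (CommHopfAlgCat.of R A))

variable {R}

/-- The homomorphism of group schemes defined by a homomorphism of Hopf algebras. -/
abbrev specGrpMap {A B : Type u} [CommRing A] [HopfAlgebra R A] [CommRing B] [HopfAlgebra R B]
    (f : A →ₐc[R] B) : specGrp R B ⟶ specGrp R A :=
  (hopfSpec (CommRingCat.of R)).map (CommHopfAlgCat.ofHom f).op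

/-- The group scheme `𝒢^(λ)`. -/
abbrev scriptG (lam : R) : GroupScheme R := specGrp R (GAlg lam)

variable (p n : ℕ) [Fact p.Prime] [Algebra (ZMod p) R] (lam : R)

/-- The group scheme `Γ^(λ)`. -/
abbrev Gam : GroupScheme R := specGrp R (GammaAlg p n lam)

/-- The unit group scheme `U(Γ^(λ))`. -/
abbrev UGam : GroupScheme R := specGrp R (UGammaAlg p n lam)

/-- The quotient group scheme `U(Γ^(λ))/Γ^(λ)`. -/
abbrev UModGam : GroupScheme R := specGrp R (UModGammaAlg p n lam)

/-- `e : Γ^(λ) → 𝒢^(λ)`. -/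
abbrev eMap : Gam p n lam ⟶ scriptG lam := specGrpMap (GAlg.toGamma p n lam)

/-- `F^n : 𝒢^(λ) → 𝒢^(λ ^ (p ^ n))`. -/
abbrev frobMap : scriptG lam ⟶ scriptG (lam ^ p ^ n) := specGrpMap (GAlg.frob p n lam)

/-- `i : Γ^(λ) → U(Γ^(λ))`. -/
abbrev iMap : Gam p n lam ⟶ UGam p n lam := specGrpMap (UAlg.toGroup (GammaAlg.basis p n lam))

/-- `q : U(Γ^(λ)) → U(Γ^(λ))/Γ^(λ)`. -/
abbrev qMap : UGam p n lam ⟶ UModGam p n lam := specGrpMap (QAlg.incl (GammaAlg.basis p n lam))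

end GroupSchemes

end GrothendieckResolution
end

open CategoryTheory GrothendieckResolution

/-!
Both rows are cleft extensions of Hopf algebras `C → A → H` with `H = 𝒪(Γ)`: `C` is the algebra of
coinvariants of `π : A → H`, and `π` has a section `ψ` which is a homomorphism of coalgebras, namely
`T ^ s ↦ T ^ s` for `A = 𝒪(𝒢^(λ))` and `T ^ s ↦ X_{T ^ s}` for `A = 𝒪(U(Γ))`. Such a `ψ` has a
convolution inverse `ψ⁻¹`, so that `a ↦ ∑ a₀ ψ⁻¹(π(a₁))` projects `A` onto `C`, and `c ⊗ h ↦ c ψ(h)`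
is an isomorphism `C ⊗ H ≅ A` of `C`-modules. This gives faithful flatness, and, as `a` and
`ψ(π(a))` agree modulo the augmentation ideal of `C`, it identifies `Spec H` with the kernel.

A homomorphism of Hopf algebras compatible with the projections to `H` maps coinvariants to
coinvariants, which yields `τ₁` and `τ₂`. As for `σ₁` and `σ₂`, a homomorphism of coalgebras
`H → A` is the same as a homomorphism of Hopf algebras `𝒪(U(Γ)) → A`, and `X_T / X_1` satisfies the
relations of the coordinate of `𝒢^(λ)` because `X_1` is group-like.
-/

open scoped TensorProduct Polynomial
open Coalgebra WithConv

noncomputable section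

namespace GrothendieckResolution

section Cleft

variable {R : Type*} [CommRing R] {A : Type*} [CommRing A] [HopfAlgebra R A]

/-- The convolution inverse `S ∘ ψ` of a homomorphism of coalgebras `ψ` into a Hopf algebra. -/
def convInv {C : Type*} [AddCommGroup C] [Module R C] [Coalgebra R C] (ψ : C →ₗc[R] A) :
    WithConv (C →ₗ[R] A) :=
  convPre ψ (toConv (HopfAlgebra.antipode R))

section

variable {C : Type*} [AddCommGroup C] [Module R C] [Coalgebra R C] (ψ : C →ₗc[R] A)

theorem toConv_mul_convInv : toConv ψ.toLinearMap * convInv ψ = 1 := by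
  have h := congr(convPre ψ $(LinearMap.id_mul_antipode (R := R) (C := A)))
  rwa [map_mul, map_one] at h

theorem convInv_mul_toConv : convInv ψ * toConv ψ.toLinearMap = 1 := by
  have h := congr(convPre ψ $(LinearMap.antipode_mul_id (R := R) (C := A)))
  rwa [map_mul, map_one] at h

theorem isUnit_toConv : IsUnit (toConv ψ.toLinearMap) :=
  ⟨⟨_, _, toConv_mul_convInv ψ, convInv_mul_toConv ψ⟩, rfl⟩

end

variable {H : Type*} [CommRing H] [HopfAlgebra R H] (π : A →ₐc[R] H) (ψ : H →ₗc[R] A)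

theorem conv_convPre_apply {B : Type*} [CommRing B] [Algebra R B] (f : A →ₗ[R] B)
    (g : WithConv (H →ₗ[R] B)) (a : A) :
    (toConv f * convPre (π : A →ₗc[R] H) g).ofConv a =
      LinearMap.mul' R B (TensorProduct.map f g.ofConv (coaction π a)) := by
  simp only [LinearMap.convMul_def, LinearMap.comp_apply, coaction, AlgHom.comp_apply,
    Bialgebra.comulAlgHom_apply]
  induction comul (R := R) a with
  | zero => simp only [map_zero]
  | add y z hy hz => simp only [map_add, hy, hz]
  | tmul y z => rfl

theorem coaction_coalgHom_apply {C : Type*} [AddCommGroup C] [Module R C] [Coalgebra R C]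
    (φ : C →ₗc[R] A) (c : C) : coaction π (φ c) =
      TensorProduct.map φ.toLinearMap ((π : A →ₗ[R] H) ∘ₗ φ.toLinearMap) (comul c) := by
  rw [coaction, AlgHom.comp_apply, Bialgebra.comulAlgHom_apply,
    ← CoalgHomClass.map_comp_comul_apply φ c]
  induction comul (R := R) c with
  | zero => simp only [map_zero]
  | add y z hy hz => simp only [map_add, hy, hz]
  | tmul y z => rfl

theorem mem_coinvariants_of_apply_eq_counit {C : Type*} [CommRing C] [HopfAlgebra R C]
    {j : C →ₐc[R] A} (hπj : ∀ c, π (j c) = algebraMap R H (counit c)) (c : C) :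
    j c ∈ coinvariants π := by
  have hcomp : (π : A →ₗ[R] H) ∘ₗ (j : C →ₗc[R] A).toLinearMap =
      Algebra.linearMap R H ∘ₗ counit := LinearMap.ext hπj
  have hmap := coaction_coalgHom_apply π (j : C →ₗc[R] A) c
  rw [hcomp, ← LinearMap.comp_id (j : C →ₗc[R] A).toLinearMap, TensorProduct.map_comp,
    LinearMap.comp_apply] at hmap
  refine hmap.trans ?_
  have hcounit := Coalgebra.lTensor_counit_comul (R := R) c
  rw [LinearMap.lTensor] at hcounit
  rw [hcounit, TensorProduct.map_tmul, Algebra.linearMap_apply, map_one]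
  rfl

theorem apply_eq_of_mem_coinvariants {c : A} (hc : c ∈ coinvariants π) :
    π c = algebraMap R H (counit c) := by
  have h := conv_apply_coinvariant π (Algebra.linearMap R H ∘ₗ counit) (toConv LinearMap.id) hc
  have hone : toConv (Algebra.linearMap R H ∘ₗ counit (R := R) (A := A)) = 1 := rfl
  rw [hone, one_mul] at h
  exact h.trans (mul_one _)

/-- The projection `a ↦ ∑ a₀ ψ⁻¹(π(a₁))` onto the coinvariants, for a section `ψ` of `π`. -/
def coinvProj : WithConv (A →ₗ[R] A) :=
  toConv LinearMap.id * convPre (π : A →ₗc[R] H) (convInv ψ)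

theorem coinvProj_mul_convPre :
    coinvProj π ψ * convPre (π : A →ₗc[R] H) (toConv ψ.toLinearMap) = toConv LinearMap.id := by
  rw [coinvProj, mul_assoc, ← map_mul, convInv_mul_toConv, map_one, mul_one]

theorem coinvProj_mul {c : A} (hc : c ∈ coinvariants π) (a : A) :
    (coinvProj π ψ).ofConv (c * a) = c * (coinvProj π ψ).ofConv a := by
  rw [coinvProj, conv_convPre_apply, conv_convPre_apply, map_mul, (mem_coinvariants π).1 hc]
  induction coaction π a with
  | zero => simp only [mul_zero, map_zero]
  | add y z hy hz => simp only [map_add, mul_add, hy, hz]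
  | tmul y z => simp [mul_assoc]

theorem counit_coinvProj (a : A) :
    counit (R := R) ((coinvProj π ψ).ofConv a) = counit (R := R) a := by
  let ε := Bialgebra.counitAlgHom R A
  have hinv : convPost ε (convInv ψ) = 1 := WithConv.ext <| LinearMap.ext fun h =>
    (HopfAlgebra.counit_antipode (R := R) (ψ h)).trans (CoalgHomClass.counit_comp_apply ψ h)
  have hpre : convPost ε (convPre (π : A →ₗc[R] H) (convInv ψ)) = 1 :=
    congr(convPre (π : A →ₗc[R] H) $hinv).trans (map_one _)
  have h : convPost ε (coinvProj π ψ) = convPost ε (toConv LinearMap.id) := by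
    rw [coinvProj, map_mul, hpre, mul_one]
  exact congr(($h).ofConv a)

variable {π ψ} (hψ : ∀ h, π (ψ h) = h)
include hψ

theorem coinvProj_section (h : H) :
    (coinvProj π ψ).ofConv (ψ h) = algebraMap R A (counit h) := by
  have hπ : convPre ψ (convPre (π : A →ₗc[R] H) (convInv ψ)) = convInv ψ :=
    WithConv.ext <| LinearMap.ext fun h => congrArg (convInv ψ).ofConv (hψ h)
  have h1 : convPre ψ (coinvProj π ψ) = 1 := by
    rw [coinvProj, map_mul, hπ]
    exact toConv_mul_convInv ψ
  exact congr(($h1).ofConv h)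

theorem coaction_section (h : H) :
    coaction π (ψ h) = TensorProduct.map ψ.toLinearMap LinearMap.id (comul h) := by
  have hid : (π : A →ₗ[R] H) ∘ₗ ψ.toLinearMap = LinearMap.id := LinearMap.ext hψ
  rw [coaction_coalgHom_apply, hid]

-- Write `ρ` for the coaction, `L` and `I` for the two inclusions into `A ⊗ H`, and compute in
-- convolution algebras: `ρ = L * Iπ` and `ρψ = Lψ * I`, so `I * ρψ⁻¹ = Lψ⁻¹`.
theorem coinvProj_mem (a : A) : (coinvProj π ψ).ofConv a ∈ coinvariants π := by
  let ρ := coaction π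
  let L : A →ₐ[R] A ⊗[R] H := Algebra.TensorProduct.includeLeft
  let I : WithConv (H →ₗ[R] A ⊗[R] H) :=
    toConv (Algebra.TensorProduct.includeRight (R := R) (A := A) (B := H)).toLinearMap
  have hρ : convPost ρ (toConv ψ.toLinearMap) = convPost L (toConv ψ.toLinearMap) * I := by
    have h := congr(convPre ψ $(coaction_eq π))
    rw [map_mul] at h
    refine h.trans congr(convPost L (toConv ψ.toLinearMap) * $(?_))
    exact WithConv.ext <| LinearMap.ext fun h => congrArg I.ofConv (hψ h)
  have hI : I * convPost ρ (convInv ψ) = convPost L (convInv ψ) := by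
    calc I * convPost ρ (convInv ψ)
      _ = convPost L (convInv ψ * toConv ψ.toLinearMap) * I * convPost ρ (convInv ψ) := by
        rw [convInv_mul_toConv, map_one, one_mul]
      _ = convPost L (convInv ψ) * convPost ρ (toConv ψ.toLinearMap * convInv ψ) := by
        rw [map_mul, mul_assoc _ _ I, ← hρ, mul_assoc, ← map_mul]
      _ = convPost L (convInv ψ) := by rw [toConv_mul_convInv, map_one, mul_one]
  have h : convPost ρ (coinvProj π ψ) = convPost L (coinvProj π ψ) := by
    rw [coinvProj, map_mul, map_mul]
    change toConv ρ.toLinearMap * convPre (π : A →ₗc[R] H) (convPost ρ (convInv ψ)) =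
      _ * convPre (π : A →ₗc[R] H) (convPost L (convInv ψ))
    rw [coaction_eq, mul_assoc, ← map_mul, hI]
  exact congr(($h).ofConv a)

theorem coinvProj_mul_section_one {c : A} (hc : c ∈ coinvariants π) :
    (coinvProj π ψ).ofConv (c * ψ 1) = c := by
  rw [coinvProj_mul π ψ hc, coinvProj_section hψ, Bialgebra.counit_one, map_one, mul_one]

theorem coinvariants_le_of_span_eq_top {B : Subalgebra R A} (hB : B ≤ coinvariants π)
    (hspan : Submodule.span B (Set.range ψ) = ⊤) : coinvariants π ≤ B := by
  intro c hc
  have hmem : c * ψ 1 ∈ Submodule.span B (Set.range ψ) := hspan ▸ Submodule.mem_top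
  rw [← coinvProj_mul_section_one hψ hc]
  generalize c * ψ 1 = a at hmem ⊢
  induction hmem using Submodule.span_induction with
  | mem x hx =>
    obtain ⟨h, rfl⟩ := hx
    rw [coinvProj_section hψ]
    exact B.algebraMap_mem _
  | zero => simpa only [map_zero] using B.zero_mem
  | add x y _ _ hx hy => simpa only [map_add] using B.add_mem hx hy
  | smul b x _ hx =>
    rw [Subalgebra.smul_def, smul_eq_mul, coinvProj_mul π ψ (hB b.2)]
    exact B.mul_mem b.2 hx

theorem apply_section_of_coinvariants {D : Type*} [CommRing D] [Algebra R D] (f : A →ₐ[R] D)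
    (hf : ∀ c ∈ coinvariants π, f c = algebraMap R D (counit c)) (a : A) :
    f (ψ (π a)) = f a := by
  have htriv : convPost f (coinvProj π ψ) = 1 := WithConv.ext <| LinearMap.ext fun a =>
    (hf _ (coinvProj_mem hψ a)).trans congr(algebraMap R D $(counit_coinvProj π ψ a))
  have h := congr(convPost f $(coinvProj_mul_convPre π ψ))
  rw [map_mul, htriv, one_mul] at h
  exact congr(($h).ofConv a)

/-- `coinvProj` as a map into the coinvariants. -/
def coinvProj' : A →ₗ[R] coinvariants π :=
  (coinvProj π ψ).ofConv.codRestrict (coinvariants π).toSubmodule (coinvProj_mem hψ)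

theorem map_coinvProj'_coaction_mul_section (c : coinvariants π) (h : H) :
    TensorProduct.map (coinvProj' hψ) LinearMap.id (coaction π (c * ψ h)) = c ⊗ₜ[R] h := by
  have hmul : ∀ a, coinvProj' hψ (c * a) = c * coinvProj' hψ a := fun a =>
    Subtype.ext (coinvProj_mul π ψ c.2 a)
  have hsec : ∀ h, coinvProj' hψ (ψ h) = algebraMap R _ (counit h) := fun h =>
    Subtype.ext (coinvProj_section hψ h)
  rw [map_mul, (mem_coinvariants π).1 c.2, coaction_section hψ]
  have hcounit := congr(TensorProduct.map (Algebra.linearMap R (coinvariants π)) LinearMap.id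
    $(Coalgebra.rTensor_counit_comul (R := R) h))
  rw [TensorProduct.map_tmul, Algebra.linearMap_apply, map_one] at hcounit
  refine Eq.trans ?_ (congr((c ⊗ₜ[R] (1 : H)) * $hcounit).trans (by simp))
  induction comul (R := R) h with
  | zero => simp only [map_zero, mul_zero]
  | add y z hy hz => simp only [map_add, mul_add, hy, hz]
  | tmul y z => simp [hmul, hsec]

/-- The normal basis isomorphism `c ⊗ h ↦ c ψ(h)`. -/
def normalBasisEquiv : coinvariants π ⊗[R] H ≃ₗ[coinvariants π] A where
  __ := ψ.toLinearMap.liftBaseChange (coinvariants π)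
  invFun a := TensorProduct.map (coinvProj' hψ) LinearMap.id (coaction π a)
  left_inv x := by
    change TensorProduct.map (coinvProj' hψ) LinearMap.id
      (coaction π (ψ.toLinearMap.liftBaseChange (coinvariants π) x)) = x
    induction x with
    | zero => simp only [map_zero]
    | add x y hx hy => simp only [map_add, hx, hy]
    | tmul c h => exact map_coinvProj'_coaction_mul_section hψ c h
  right_inv a := by
    refine Eq.trans ?_ congr(($(coinvProj_mul_convPre π ψ)).ofConv a)
    rw [conv_convPre_apply π (coinvProj π ψ).ofConv]
    change ψ.toLinearMap.liftBaseChange (coinvariants π)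
      (TensorProduct.map (coinvProj' hψ) LinearMap.id (coaction π a)) = _
    induction coaction π a with
    | zero => simp only [map_zero]
    | add y z hy hz => simp only [map_add, hy, hz]
    | tmul y z => rfl

end Cleft

theorem faithfullyFlat_of_flat_bialgebra {R H : Type*} [CommRing R] [CommRing H]
    [Bialgebra R H] [Module.Flat R H] : Module.FaithfullyFlat R H :=
  .of_comap_surjective fun P => by
    have hcomp : (Bialgebra.counitAlgHom R H : H →+* R).comp (algebraMap R H) = .id R :=
      RingHom.ext fun r => Bialgebra.counit_algebraMap r
    refine ⟨P.comap (Bialgebra.counitAlgHom R H : H →+* R), ?_⟩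
    rw [← PrimeSpectrum.comap_comp_apply, hcomp, PrimeSpectrum.comap_id]

/-- A cleft extension `C → A → H` of Hopf algebras: `j` is an isomorphism onto the coinvariants of
`π`, and `π` has a section which is a homomorphism of coalgebras. (In general the section is only
required to be convolution-invertible and `H`-colinear.) -/
structure IsCleftExtension {R C A H : Type*} [CommRing R] [CommRing C] [CommRing A] [CommRing H]
    [HopfAlgebra R C] [HopfAlgebra R A] [HopfAlgebra R H] (j : C →ₐc[R] A) (π : A →ₐc[R] H) :
    Prop where
  injective : Function.Injective j
  range_eq : (j : C →ₐ[R] A).range = coinvariants π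
  exists_section : ∃ ψ : H →ₗc[R] A, ∀ h, π (ψ h) = h

namespace IsCleftExtension

section

variable {R C A H : Type*} [CommRing R] [CommRing C] [CommRing A] [CommRing H]
  [HopfAlgebra R C] [HopfAlgebra R A] [HopfAlgebra R H] {j : C →ₐc[R] A} {π : A →ₐc[R] H}

theorem map_mem (hjπ : IsCleftExtension j π) (c : C) : j c ∈ coinvariants π :=
  hjπ.range_eq ▸ ⟨c, rfl⟩

/-- The base algebra of a cleft extension is the algebra of coinvariants. -/
def coinvariantsEquiv (hjπ : IsCleftExtension j π) : C ≃ₐ[R] coinvariants π :=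
  (AlgEquiv.ofInjective (j : C →ₐ[R] A) hjπ.injective).trans
    (Subalgebra.equivOfEq _ _ hjπ.range_eq)

theorem exists_eq (hjπ : IsCleftExtension j π) {a : A} (ha : a ∈ coinvariants π) :
    ∃ c, j c = a := by
  rwa [← hjπ.range_eq] at ha

theorem surjective (hjπ : IsCleftExtension j π) : Function.Surjective π :=
  hjπ.exists_section.elim fun ψ hψ h => ⟨ψ h, hψ h⟩

theorem apply_comp (hjπ : IsCleftExtension j π) (c : C) :
    π (j c) = algebraMap R H (counit c) := by
  rw [apply_eq_of_mem_coinvariants π (hjπ.map_mem c), CoalgHomClass.counit_comp_apply]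

theorem injective_map (hjπ : IsCleftExtension j π) :
    Function.Injective (TensorProduct.map (j : C →ₗ[R] A) (j : C →ₗ[R] A)) := by
  obtain ⟨ψ, hψ⟩ := hjπ.exists_section
  let r : A →ₗ[R] C := hjπ.coinvariantsEquiv.symm.toLinearMap ∘ₗ coinvProj' hψ ∘ₗ
    LinearMap.mulRight R (ψ 1)
  have hr : r ∘ₗ (j : C →ₗ[R] A) = LinearMap.id := LinearMap.ext fun c => by
    refine (hjπ.coinvariantsEquiv.symm_apply_eq (y := c)).2 (Subtype.ext ?_)
    exact coinvProj_mul_section_one hψ (hjπ.map_mem c)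
  refine Function.LeftInverse.injective (g := TensorProduct.map r r) fun x => ?_
  rw [← LinearMap.comp_apply, ← TensorProduct.map_comp, hr, TensorProduct.map_id,
    LinearMap.id_apply]

theorem exists_factor {D : Type*} [CommRing D] [Algebra R D] (hjπ : IsCleftExtension j π)
    (f : A →ₐ[R] D) (hf : ∀ c, f (j c) = algebraMap R D (counit c)) :
    ∃ g : H →ₐ[R] D, ∀ a, g (π a) = f a := by
  obtain ⟨ψ, hψ⟩ := hjπ.exists_section
  have hcoinv : ∀ c ∈ coinvariants π, f c = algebraMap R D (counit c) := fun c hc => by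
    obtain ⟨c, rfl⟩ := hjπ.exists_eq hc
    rw [hf, CoalgHomClass.counit_comp_apply]
  have hker : RingHom.ker (π : A →ₐ[R] H) ≤ RingHom.ker f := fun a (ha : π a = 0) => by
    rw [RingHom.mem_ker, ← apply_section_of_coinvariants hψ f hcoinv, ha, map_zero, map_zero]
  exact ⟨AlgHom.liftOfSurjective (π : A →ₐ[R] H) hjπ.surjective f hker, fun a =>
    AlgHom.liftOfSurjective_apply _ _ _ _ _⟩

theorem eq_algebraMap_comp (hjπ : IsCleftExtension j π) : (j : C →+* A) =
    (algebraMap (coinvariants π) A).comp (hjπ.coinvariantsEquiv : C →+* coinvariants π) := rfl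

end

section

universe v

variable {R H : Type*} {C A : Type v} [CommRing R] [CommRing C] [CommRing A] [CommRing H]
  [HopfAlgebra R C] [HopfAlgebra R A] [HopfAlgebra R H] {j : C →ₐc[R] A} {π : A →ₐc[R] H}

theorem faithfullyFlat [Module.Flat R H] (hjπ : IsCleftExtension j π) :
    (j : C →+* A).FaithfullyFlat := by
  obtain ⟨ψ, hψ⟩ := hjπ.exists_section
  have := faithfullyFlat_of_flat_bialgebra (R := R) (H := H)
  rw [eq_algebraMap_comp hjπ]
  exact RingHom.FaithfullyFlat.stableUnderComposition _ _
    (.of_bijective hjπ.coinvariantsEquiv.bijective)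
    (RingHom.faithfullyFlat_algebraMap_iff.2 (.of_linearEquiv _ _ (normalBasisEquiv hψ).symm))

theorem finitePresentation [Module.Finite R H] [Module.Projective R H]
    (hjπ : IsCleftExtension j π) : (j : C →+* A).FinitePresentation := by
  obtain ⟨ψ, hψ⟩ := hjπ.exists_section
  have := Module.Finite.equiv (normalBasisEquiv hψ)
  have := Module.Projective.of_equiv (normalBasisEquiv hψ)
  have := Module.finitePresentation_of_projective (coinvariants π) A
  rw [eq_algebraMap_comp hjπ]
  refine .comp ?_ (.of_bijective hjπ.coinvariantsEquiv.bijective)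
  rw [RingHom.finitePresentation_algebraMap]
  infer_instance

end

end IsCleftExtension

theorem map_mem_coinvariants {R A B H : Type*} [CommRing R] [CommRing A] [CommRing B]
    [CommRing H] [HopfAlgebra R A] [HopfAlgebra R B] [HopfAlgebra R H] {f : A →ₐc[R] B}
    {π : A →ₐc[R] H} {ρ : B →ₐc[R] H}
    (h : ρ.comp f = π) {a : A} (ha : a ∈ coinvariants π) : f a ∈ coinvariants ρ := by
  have hcoaction : coaction ρ (f a) =
      Algebra.TensorProduct.map (f : A →ₐ[R] B) (.id R H) (coaction π a) := by
    subst h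
    simp only [coaction, AlgHom.comp_apply, Bialgebra.comulAlgHom_apply,
      ← CoalgHomClass.map_comp_comul_apply f a]
    induction comul (R := R) a with
    | zero => simp only [map_zero]
    | add y z hy hz => simp only [map_add, hy, hz]
    | tmul y z => rfl
  rw [mem_coinvariants] at ha ⊢
  rw [hcoaction, ha, Algebra.TensorProduct.map_tmul, map_one]
  rfl

theorem exists_bialgHom_comp_eq {R A B C : Type*} [CommRing R] [CommRing A] [CommRing B]
    [CommRing C] [Bialgebra R A] [Bialgebra R B] [Bialgebra R C] {j : C →ₐc[R] A}
    (hj : Function.Injective j)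
    (hjj : Function.Injective (TensorProduct.map (j : C →ₗ[R] A) (j : C →ₗ[R] A)))
    {f : B →ₐc[R] A} (hf : ∀ x, ∃ c, j c = f x) : ∃ t : B →ₐc[R] C, j.comp t = f := by
  let t : B →ₐ[R] C := (AlgEquiv.ofInjective (j : C →ₐ[R] A) hj).symm.toAlgHom.comp
    ((f : B →ₐ[R] A).codRestrict _ hf)
  have ht : ∀ x, j (t x) = f x := fun x =>
    congr(Subtype.val $((AlgEquiv.ofInjective (j : C →ₐ[R] A) hj).apply_symm_apply
      ((f : B →ₐ[R] A).codRestrict _ hf x)))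
  have hcounit : ∀ x, counit (R := R) (t x) = counit (R := R) x := fun x => by
    rw [← CoalgHomClass.counit_comp_apply j (t x), ht, CoalgHomClass.counit_comp_apply]
  have hcomul : ∀ x, Algebra.TensorProduct.map t t (comul (R := R) x) = comul (t x) := fun x => by
    refine hjj (Eq.trans ?_ (CoalgHomClass.map_comp_comul_apply j (t x)).symm)
    rw [ht, ← CoalgHomClass.map_comp_comul_apply f x]
    induction comul (R := R) x with
    | zero => simp only [map_zero]
    | add y z hy hz => simp only [map_add, hy, hz]
    | tmul y z => exact congr($(ht y) ⊗ₜ[R] $(ht z))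
  exact ⟨.ofAlgHom t (AlgHom.ext hcounit) (AlgHom.ext hcomul), BialgHom.ext ht⟩

section Schemes

open CategoryTheory AlgebraicGeometry MonoidalCategory CartesianMonoidalCategory MonObj

variable {R : Type u} [CommRing R]

theorem isPushout_commAlgCat {C A H : Type u} [CommRing C] [CommRing A] [CommRing H]
    [Algebra R C] [Algebra R A] [Algebra R H] (j : C →ₐ[R] A) (π : A →ₐ[R] H) (ε : C →ₐ[R] R)
    (hπ : Function.Surjective π) (hcomm : π.comp j = (Algebra.ofId R H).comp ε)
    (hlift : ∀ (D : Type u) [CommRing D] [Algebra R D] (f : A →ₐ[R] D),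
      f.comp j = (Algebra.ofId R D).comp ε → ∃ g : H →ₐ[R] D, g.comp π = f) :
    IsPushout (CommAlgCat.ofHom j) (CommAlgCat.ofHom ε) (CommAlgCat.ofHom π)
      (CommAlgCat.ofHom (Algebra.ofId R H)) := by
  refine ⟨⟨by rw [← CommAlgCat.ofHom_comp, ← CommAlgCat.ofHom_comp, hcomm]⟩,
    ⟨Limits.PushoutCocone.isColimitAux' _ fun s => ?_⟩⟩
  have hs : s.inl.hom.comp j = (Algebra.ofId R s.pt).comp ε :=
    congr(($(s.condition)).hom).trans (AlgHom.ext fun c => s.inr.hom.commutes (ε c))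
  have hg := (hlift s.pt s.inl.hom hs).choose_spec
  refine ⟨CommAlgCat.ofHom (hlift s.pt s.inl.hom hs).choose, CommAlgCat.hom_ext hg,
    CommAlgCat.hom_ext (Subsingleton.elim _ _), fun {m} hm _ => ?_⟩
  refine CommAlgCat.hom_ext (AlgHom.ext (hπ.forall.2 fun a => ?_))
  exact congr(($hm).hom a).trans congr($hg a).symm

theorem isPullback_hopfSpec {R : CommRingCat.{u}} {C A H : CommHopfAlgCat.{u} R} (j : C ⟶ A)
    (π : A ⟶ H)
    (hp : IsPushout (CommAlgCat.ofHom (j.hom : C →ₐ[R] A))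
      (CommAlgCat.ofHom (Bialgebra.counitAlgHom R C))
      (CommAlgCat.ofHom (π.hom : A →ₐ[R] H)) (CommAlgCat.ofHom (Algebra.ofId R H))) :
    IsPullback ((hopfSpec R).map π.op).hom.hom (toUnit ((hopfSpec R).obj (.op H)).X)
      ((hopfSpec R).map j.op).hom.hom η[((hopfSpec R).obj (.op C)).X] :=
  (hp.op.map (algSpec R)).flip.of_iso (Iso.refl _) (Iso.refl _)
    (Functor.Monoidal.εIso (algSpec R)).symm (Iso.refl _)
    ((Category.id_comp _).trans (Category.comp_id _).symm |>.symm) (toUnit_unique _ _)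
    ((Category.id_comp _).trans (Category.comp_id _).symm |>.symm) rfl

variable {A B C H : Type u} [CommRing A] [CommRing B] [CommRing C] [CommRing H]
  [HopfAlgebra R A] [HopfAlgebra R B] [HopfAlgebra R C] [HopfAlgebra R H]

theorem specGrpMap_comp (f : A →ₐc[R] B) (g : B →ₐc[R] C) :
    specGrpMap g ≫ specGrpMap f = specGrpMap (g.comp f) :=
  ((hopfSpec (CommRingCat.of R)).map_comp _ _).symm

theorem specGrpMap_bijective :
    Function.Bijective (specGrpMap : (A →ₐc[R] B) → (specGrp R B ⟶ specGrp R A)) := by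
  let e := hopfSpec.fullyFaithful (R := CommRingCat.of R)
  refine ⟨fun f g hfg => ?_, fun τ => ?_⟩
  · exact congr(($(e.map_injective hfg)).unop.hom)
  · obtain ⟨s, rfl⟩ := e.map_surjective τ
    exact ⟨s.unop.hom, rfl⟩

theorem existsUnique_specGrpMap_comp {j : C →ₐc[R] A} (hj : Function.Injective j)
    (hjj : Function.Injective (TensorProduct.map (j : C →ₗ[R] A) (j : C →ₗ[R] A)))
    {f : B →ₐc[R] A} (hf : ∀ x, ∃ c, j c = f x) :
    ∃! τ : specGrp R C ⟶ specGrp R B, specGrpMap j ≫ τ = specGrpMap f := by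
  obtain ⟨t, ht⟩ := exists_bialgHom_comp_eq hj hjj hf
  refine ⟨specGrpMap t, by simp only [specGrpMap_comp, ht], fun τ hτ => ?_⟩
  obtain ⟨s, rfl⟩ := specGrpMap_bijective.surjective τ
  have hs : j.comp s = f := specGrpMap_bijective.injective ((specGrpMap_comp s j).symm.trans hτ)
  congr 1
  exact BialgHom.ext fun x => hj congr($(hs.trans ht.symm) x)

namespace IsCleftExtension

theorem isPullback {j : C →ₐc[R] A} {π : A →ₐc[R] H} (hjπ : IsCleftExtension j π) :
    IsPullback (specGrpMap π).hom.hom (toUnit (specGrp R H).X) (specGrpMap j).hom.hom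
      η[(specGrp R C).X] := by
  refine isPullback_hopfSpec (R := CommRingCat.of R) _ _ (isPushout_commAlgCat (j : C →ₐ[R] A)
    (π : A →ₐ[R] H) (Bialgebra.counitAlgHom R C) hjπ.surjective (AlgHom.ext hjπ.apply_comp)
    fun D _ _ f hf => ?_)
  obtain ⟨g, hg⟩ := hjπ.exists_factor f fun c => congr($hf c)
  exact ⟨g, AlgHom.ext hg⟩

theorem shortExact [Module.Finite R H] [Module.Projective R H] {j : C →ₐc[R] A} {π : A →ₐc[R] H}
    (hjπ : IsCleftExtension j π) : ShortExact (specGrpMap π) (specGrpMap j) := by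
  have hleft : (specGrpMap j).hom.hom.left = Spec.map (CommRingCat.ofHom (j : C →+* A)) := rfl
  obtain ⟨hflat, hsurj⟩ := (flat_and_surjective_SpecMap_iff (CommRingCat.ofHom (j : C →+* A))).2
    hjπ.faithfullyFlat
  exact ⟨hjπ.isPullback, hleft ▸ hflat, hleft ▸ hsurj,
    hleft ▸ (LocallyOfFinitePresentation.SpecMap_iff _).2 hjπ.finitePresentation⟩

theorem existsUnique_quotientMap {D : Type u} [CommRing D] [HopfAlgebra R D] {j : C →ₐc[R] A}
    {π : A →ₐc[R] H} {k : D →ₐc[R] B} {ρ : B →ₐc[R] H} (hjπ : IsCleftExtension j π)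
    (hkρ : IsCleftExtension k ρ) {f : A →ₐc[R] B} (hf : ρ.comp f = π) :
    ∃! τ : specGrp R D ⟶ specGrp R C, specGrpMap k ≫ τ = specGrpMap f ≫ specGrpMap j := by
  rw [specGrpMap_comp]
  exact existsUnique_specGrpMap_comp hkρ.injective hkρ.injective_map fun c =>
    hkρ.exists_eq (map_mem_coinvariants hf (hjπ.map_mem c))

end IsCleftExtension
end Schemes

/-- The relations satisfied by the coordinate `T` of `𝒢^(λ)`: the homomorphisms of Hopf algebras
`𝒪(𝒢^(λ)) → A` correspond to the `x : A` satisfying them. For `λ = 0` these are the primitive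
elements. -/
structure IsLamPrimitive {R A : Type*} [CommRing R] [CommRing A] [Bialgebra R A] (lam : R)
    (x : A) : Prop where
  counit_eq : counit (R := R) x = 0
  comul_eq : comul (R := R) x = x ⊗ₜ 1 + 1 ⊗ₜ x + lam • x ⊗ₜ x

namespace IsLamPrimitive

variable {R A : Type*} [CommRing R] [CommRing A] {lam : R} {x : A}

theorem comul_eq' [Bialgebra R A] (hx : IsLamPrimitive lam x) :
    comul (R := R) x = x ⊗ₜ 1 + (1 + lam • x) ⊗ₜ x := by
  rw [hx.comul_eq, TensorProduct.add_tmul, TensorProduct.smul_tmul', add_assoc]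

theorem isGroupLikeElem_one_add [Bialgebra R A] (hx : IsLamPrimitive lam x) :
    IsGroupLikeElem R (1 + lam • x) where
  counit_eq_one := by simp [hx.counit_eq]
  comul_eq_tmul_self := by
    simp only [map_add, map_smul, Bialgebra.comul_one, Algebra.TensorProduct.one_def,
      hx.comul_eq', TensorProduct.add_tmul, TensorProduct.tmul_add, TensorProduct.tmul_smul,
      ← TensorProduct.smul_tmul', smul_add]
    abel

theorem isUnit_one_add [HopfAlgebra R A] (hx : IsLamPrimitive lam x) :
    IsUnit (1 + algebraMap R A lam * x) := by
  rw [← Algebra.smul_def]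
  exact hx.isGroupLikeElem_one_add.isUnit

theorem comul_pow [Bialgebra R A] (hx : IsLamPrimitive lam x) (k : ℕ) :
    comul (R := R) (x ^ k) = ∑ m ∈ Finset.range (k + 1),
      k.choose m • (x ^ m * (1 + lam • x) ^ (k - m)) ⊗ₜ (x ^ (k - m)) := by
  rw [Bialgebra.comul_pow, hx.comul_eq', add_pow]
  simp only [Algebra.TensorProduct.tmul_pow, one_pow, Algebra.TensorProduct.tmul_mul_tmul,
    one_mul, nsmul_eq_mul']

end IsLamPrimitive

section Homs

variable {R : Type u} [CommRing R]

theorem GAlg.isLamPrimitive_T (lam : R) : IsLamPrimitive lam (T lam) :=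
  ⟨by simp, by simp⟩

/-- The homomorphism `Spec A → 𝒢^(λ)` of group schemes with coordinate `x`. -/
def GAlg.liftBialgHom {A : Type*} [CommRing A] [HopfAlgebra R A] {lam : R} {x : A}
    (hx : IsLamPrimitive lam x) : GAlg lam →ₐc[R] A :=
  .ofAlgHom (lift x hx.isUnit_one_add)
    (algHom_ext (by simp [hx.counit_eq]))
    (algHom_ext (by simp [hx.comul_eq]))

theorem GAlg.liftBialgHom_T {A : Type*} [CommRing A] [HopfAlgebra R A] {lam : R} {x : A}
    (hx : IsLamPrimitive lam x) : liftBialgHom hx (T lam) = x :=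
  lift_T _ hx.isUnit_one_add

theorem GAlg.bialgHom_ext {A : Type*} [CommRing A] [Bialgebra R A] {lam : R}
    {f g : GAlg lam →ₐc[R] A} (h : f (T lam) = g (T lam)) : f = g := by
  have hfg : (f : GAlg lam →ₐ[R] A) = (g : GAlg lam →ₐ[R] A) := algHom_ext h
  exact BialgHom.ext fun x => congr($hfg x)

theorem IsLamPrimitive.mul_antipode {H A : Type*} [CommRing H] [Bialgebra R H] [CommRing A]
    [HopfAlgebra R A] {lam : R} {x : H} (hx : IsLamPrimitive lam x) (ψ : H →ₗc[R] A) :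
    IsLamPrimitive lam (ψ x * HopfAlgebra.antipode R (ψ 1)) where
  counit_eq := by simp [Bialgebra.counit_mul, hx.counit_eq]
  comul_eq := by
    have hone : IsGroupLikeElem R (ψ 1) := IsGroupLikeElem.one.map ψ
    have hx' : comul (R := R) (ψ x) = ψ x ⊗ₜ ψ 1 + ψ 1 ⊗ₜ ψ x + lam • ψ x ⊗ₜ ψ x := by
      rw [← CoalgHomClass.map_comp_comul_apply ψ x, hx.comul_eq]
      simp
    rw [Bialgebra.comul_mul, hx', hone.antipode.comul_eq_tmul_self]
    simp only [add_mul, smul_mul_assoc, Algebra.TensorProduct.tmul_mul_tmul,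
      hone.mul_antipode_cancel]

end Homs

namespace UAlg

variable {R : Type u} [CommRing R] {H : Type*} [CommRing H] [HopfAlgebra R H] [IsCocomm R H]
  {ι : Type*} [Fintype ι] [DecidableEq ι] (b : Module.Basis ι R H)

/-- The universal linear map as a homomorphism of coalgebras. -/
def univCoalgHom : H →ₗc[R] UAlg b where
  __ := univ b
  counit_comp := LinearMap.ext fun h => counit_univ b h
  map_comp_comul := LinearMap.ext fun h => (comul_univ b h).symm

variable {A : Type*} [CommRing A] [HopfAlgebra R A]

/-- The homomorphism `Spec A → U(Γ)` of group schemes defined by a homomorphism of coalgebras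
`ψ : 𝒪(Γ) → A`. -/
def liftCoalgHom (ψ : H →ₗc[R] A) : UAlg b →ₐc[R] A :=
  .ofAlgHom (lift b ψ.toLinearMap (isUnit_toConv ψ))
    (algHom_ext <| LinearMap.ext fun h => by
      simp [counit_univ])
    (algHom_ext <| LinearMap.ext fun h => by
      simp only [LinearMap.comp_apply, AlgHom.toLinearMap_apply,
        AlgHom.comp_apply, Bialgebra.comulAlgHom_apply, comul_univ, lift_univ]
      refine Eq.trans ?_ (CoalgHomClass.map_comp_comul_apply ψ h)
      induction comul (R := R) h with
      | zero => simp only [map_zero]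
      | add y z hy hz => simp only [map_add, hy, hz]
      | tmul y z => simp)

theorem liftCoalgHom_univ (ψ : H →ₗc[R] A) (h : H) : liftCoalgHom b ψ (univ b h) = ψ h :=
  lift_univ b ψ.toLinearMap (isUnit_toConv ψ) h

theorem comp_liftCoalgHom {π : A →ₐc[R] H} {ψ : H →ₗc[R] A} (hψ : ∀ h, π (ψ h) = h) :
    π.comp (liftCoalgHom b ψ) = toGroup b := by
  have h : (π : A →ₐ[R] H).comp (liftCoalgHom b ψ : UAlg b →ₐ[R] A) =
      (toGroup b : UAlg b →ₐ[R] H) :=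
    algHom_ext <| LinearMap.ext fun x => by simp [liftCoalgHom_univ, hψ]
  exact BialgHom.ext fun x => congr($h x)

end UAlg

theorem mul_antipode_one_mul_one {R H A : Type*} [CommRing R] [CommRing H] [Bialgebra R H]
    [CommRing A] [HopfAlgebra R A] (ψ : H →ₗc[R] A) (h : H) :
    ψ h * HopfAlgebra.antipode R (ψ 1) * ψ 1 = ψ h := by
  rw [mul_assoc, (IsGroupLikeElem.one.map ψ).antipode_mul_cancel, mul_one]

theorem map_mul_antipode_one {R H A : Type*} [CommRing R] [CommRing H] [Bialgebra R H]
    [CommRing A] [HopfAlgebra R A] {π : A →ₐc[R] H} {ψ : H →ₗc[R] A} (hψ : ∀ h, π (ψ h) = h)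
    (h : H) : π (ψ h * HopfAlgebra.antipode R (ψ 1)) = h := by
  simpa only [map_mul, hψ, mul_one] using congr(π $(mul_antipode_one_mul_one ψ h))

theorem comp_liftBialgHom_mul_antipode {R : Type u} {H A : Type*} [CommRing R] [CommRing H]
    [HopfAlgebra R H] [CommRing A] [HopfAlgebra R A] {π : A →ₐc[R] H} {ψ : H →ₗc[R] A}
    (hψ : ∀ h, π (ψ h) = h) {lam : R} {x : H} (hx : IsLamPrimitive lam x) :
    π.comp (GAlg.liftBialgHom (hx.mul_antipode ψ)) = GAlg.liftBialgHom hx :=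
  GAlg.bialgHom_ext <| by
    rw [BialgHom.comp_apply, GAlg.liftBialgHom_T, GAlg.liftBialgHom_T, map_mul_antipode_one hψ]

theorem QAlg.isCleftExtension {R : Type u} [CommRing R] {H : Type*} [CommRing H]
    [HopfAlgebra R H] [IsCocomm R H] {ι : Type*} [Fintype ι] [DecidableEq ι]
    (b : Module.Basis ι R H) : IsCleftExtension (incl b) (UAlg.toGroup b) where
  injective := Subtype.val_injective
  range_eq := (coinvariants (UAlg.toGroup b)).range_val
  exists_section := ⟨UAlg.univCoalgHom b, UAlg.toGroup_univ b⟩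

theorem adjoinRoot_of_injective {S : Type*} [CommRing S] {g : S[X]} (hg : g.Monic)
    (hdeg : g.natDegree ≠ 0) : Function.Injective (AdjoinRoot.of g) := by
  refine (injective_iff_map_eq_zero _).2 fun x hx => by_contra fun hx0 => ?_
  refine hg.not_dvd_of_natDegree_lt (Polynomial.C_ne_zero.2 hx0) ?_ (AdjoinRoot.mk_eq_zero.1 hx)
  rw [Polynomial.natDegree_C]
  exact hdeg.bot_lt

section Frobenius

variable {R : Type u} [CommRing R] (p n : ℕ) (lam : R)

namespace GAlg

/-- The equation `X ^ (p ^ n) = T` of the coordinate of `𝒢^(λ)` over `𝒢^(λ ^ (p ^ n))`. -/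
abbrev frobPoly : (GAlg (lam ^ p ^ n))[X] := Polynomial.X ^ p ^ n - Polynomial.C (T (lam ^ p ^ n))

theorem root_frobPoly_pow : AdjoinRoot.root (frobPoly p n lam) ^ p ^ n =
    AdjoinRoot.of (frobPoly p n lam) (T (lam ^ p ^ n)) := by
  simpa [sub_eq_zero] using AdjoinRoot.eval₂_root (frobPoly p n lam)

variable [Fact p.Prime] [Algebra (ZMod p) R]

theorem isUnit_one_add_root : IsUnit (1 + algebraMap R (AdjoinRoot (frobPoly p n lam)) lam *
    AdjoinRoot.root (frobPoly p n lam)) := by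
  rw [← isUnit_pow_iff (pow_ne_zero n (Fact.out : p.Prime).ne_zero),
    add_pow_prime_pow_of_algebra (R := R), one_pow, mul_pow, root_frobPoly_pow, ← map_pow]
  have h := (isUnit_one_add (lam := lam ^ p ^ n)).map (AdjoinRoot.of (frobPoly p n lam))
  rwa [map_add, map_one, map_mul] at h

@[simp] theorem frob_T : frob p n lam (T (lam ^ p ^ n)) = T lam ^ p ^ n := by
  simp [frob]

/-- The description of `𝒪(𝒢^(λ))` as the extension of `𝒪(𝒢^(λ ^ (p ^ n)))` by a `p ^ n`-th root of
`T`, along `F^n`. -/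
def adjoinRootEquiv : AdjoinRoot (frobPoly p n lam) ≃ₐ[R] GAlg lam :=
  .ofAlgHom
    (AdjoinRoot.liftAlgHom (frobPoly p n lam) (frob p n lam : GAlg (lam ^ p ^ n) →ₐ[R] GAlg lam)
      (T lam) (by simp [Polynomial.eval₂_sub]))
    (lift (AdjoinRoot.root (frobPoly p n lam)) (isUnit_one_add_root p n lam))
    (algHom_ext (by simp))
    (AdjoinRoot.algHom_ext' (algHom_ext (by simp [root_frobPoly_pow])) (by simp))

theorem adjoinRootEquiv_of (x : GAlg (lam ^ p ^ n)) :
    adjoinRootEquiv p n lam (AdjoinRoot.of _ x) = frob p n lam x := by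
  simp [adjoinRootEquiv]

theorem adjoinRootEquiv_root : adjoinRootEquiv p n lam (AdjoinRoot.root _) = T lam := by
  simp [adjoinRootEquiv]

theorem frob_injective : Function.Injective (frob p n lam) := by
  cases subsingleton_or_nontrivial (GAlg (lam ^ p ^ n))
  · exact Function.injective_of_subsingleton _
  have hpn : p ^ n ≠ 0 := pow_ne_zero _ (Fact.out : p.Prime).ne_zero
  have hof := adjoinRoot_of_injective (Polynomial.monic_X_pow_sub_C (T (lam ^ p ^ n)) hpn)
    (Polynomial.natDegree_X_pow_sub_C.trans_ne hpn)
  have hcomp := (adjoinRootEquiv p n lam).injective.comp hof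
  exact fun x y hxy => hcomp (by
    simpa only [Function.comp_apply, adjoinRootEquiv_of] using hxy)

/-- The image of `F^n` on coordinate rings, as a subalgebra in order to serve as a ring of
scalars. -/
abbrev frobRange : Subalgebra R (GAlg lam) :=
  (frob p n lam : GAlg (lam ^ p ^ n) →ₐ[R] GAlg lam).range

theorem span_range_pow_T : Submodule.span (frobRange p n lam)
    (Set.range fun k : ℕ => T lam ^ k) = ⊤ := by
  refine eq_top_iff.2 fun x _ => ?_
  obtain ⟨y, rfl⟩ := (adjoinRootEquiv p n lam).surjective x
  obtain ⟨f, rfl⟩ := AdjoinRoot.mk_surjective y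
  induction f using Polynomial.induction_on' with
  | add f g hf hg => simpa only [map_add] using add_mem (hf trivial) (hg trivial)
  | monomial k c =>
    rw [← Polynomial.C_mul_X_pow_eq_monomial, map_mul, map_pow, AdjoinRoot.mk_C, AdjoinRoot.mk_X,
      map_mul, map_pow, adjoinRootEquiv_of, adjoinRootEquiv_root]
    have hT : T lam ^ k ∈ Submodule.span (frobRange p n lam)
        (Set.range fun k : ℕ => T lam ^ k) := Submodule.subset_span ⟨k, rfl⟩
    exact Submodule.smul_mem _ (⟨_, c, rfl⟩ : frobRange p n lam) hT

@[simp] theorem toGamma_T : toGamma p n lam (T lam) = GammaAlg.T p n lam :=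
  lift_T _ GammaAlg.isUnit_one_add

theorem toGamma_frob (c : GAlg (lam ^ p ^ n)) :
    toGamma p n lam (frob p n lam c) = algebraMap R (GammaAlg p n lam) (counit c) := by
  have h : (toGamma p n lam : GAlg lam →ₐ[R] GammaAlg p n lam).comp (frob p n lam) =
      (Algebra.ofId R _).comp (Bialgebra.counitAlgHom R (GAlg (lam ^ p ^ n))) :=
    algHom_ext (by simp [GammaAlg.T_pow])
  exact congr($h c)

theorem frobRange_le_coinvariants : frobRange p n lam ≤ coinvariants (toGamma p n lam) := by
  rintro _ ⟨c, rfl⟩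
  exact mem_coinvariants_of_apply_eq_counit _ (toGamma_frob p n lam) c

end GAlg

/-- The linear section `T ^ s ↦ T ^ s`, `0 ≤ s < p ^ n`, of the projection `𝒪(𝒢^(λ)) → 𝒪(Γ)`. -/
def gammaSection : GammaAlg p n lam →ₗ[R] GAlg lam :=
  (GammaAlg.basis p n lam).constr R fun s => GAlg.T lam ^ (s : ℕ)

theorem gammaSection_T_pow {k : ℕ} (hk : k < p ^ n) :
    gammaSection p n lam (GammaAlg.T p n lam ^ k) = GAlg.T lam ^ k := by
  rw [← GammaAlg.basis_apply p n lam ⟨k, hk⟩, gammaSection, Module.Basis.constr_basis]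

theorem gammaSection_aeval_T {f : R[X]} (hf : f.natDegree < p ^ n) :
    gammaSection p n lam (f.aeval (GammaAlg.T p n lam)) = f.aeval (GAlg.T lam) := by
  rw [Polynomial.aeval_eq_sum_range' hf, Polynomial.aeval_eq_sum_range' hf, map_sum]
  exact Finset.sum_congr rfl fun i hi => by
    rw [map_smul, gammaSection_T_pow p n lam (Finset.mem_range.1 hi)]

variable [Fact p.Prime] [Algebra (ZMod p) R]

theorem toGamma_gammaSection (h : GammaAlg p n lam) :
    GAlg.toGamma p n lam (gammaSection p n lam h) = h := by
  have hid : (GAlg.toGamma p n lam : GAlg lam →ₐ[R] GammaAlg p n lam).toLinearMap ∘ₗ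
      gammaSection p n lam = LinearMap.id :=
    (GammaAlg.basis p n lam).ext fun s => by
      simp [GammaAlg.basis_apply, gammaSection_T_pow p n lam s.2]
  exact congr($hid h)

theorem span_range_gammaSection : Submodule.span (GAlg.frobRange p n lam)
    (Set.range (gammaSection p n lam)) = ⊤ := by
  rw [eq_top_iff, ← GAlg.span_range_pow_T p n lam, Submodule.span_le]
  rintro _ ⟨k, rfl⟩
  have hk : k % p ^ n < p ^ n := Nat.mod_lt _ (pow_pos (Fact.out : p.Prime).pos n)
  have hT : GAlg.T lam ^ k = GAlg.frob p n lam (GAlg.T _ ^ (k / p ^ n)) *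
      gammaSection p n lam (GammaAlg.T p n lam ^ (k % p ^ n)) := by
    rw [gammaSection_T_pow p n lam hk, map_pow, GAlg.frob_T, ← pow_mul, ← pow_add,
      Nat.div_add_mod]
  have hmem : gammaSection p n lam (GammaAlg.T p n lam ^ (k % p ^ n)) ∈
      Submodule.span (GAlg.frobRange p n lam)
        (Set.range (gammaSection p n lam)) := Submodule.subset_span ⟨_, rfl⟩
  change GAlg.T lam ^ k ∈ _
  rw [hT]
  exact Submodule.smul_mem _
    (⟨_, _, rfl⟩ : GAlg.frobRange p n lam) hmem

theorem GammaAlg.isLamPrimitive_T : IsLamPrimitive lam (T p n lam) :=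
  ⟨counit_T, comul_T⟩

-- By `comul_pow`, `Δ(T ^ k)` is given by the same polynomials of degree at most `k < p ^ n` in
-- `𝒪(𝒢^(λ))` and in `𝒪(Γ)`, so no truncation occurs.
theorem map_gammaSection_comul_T_pow {k : ℕ} (hk : k < p ^ n) :
    TensorProduct.map (gammaSection p n lam) (gammaSection p n lam)
      (comul (R := R) (GammaAlg.T p n lam ^ k)) = comul (R := R) (GAlg.T lam ^ k) := by
  rw [(GammaAlg.isLamPrimitive_T p n lam).comul_pow, (GAlg.isLamPrimitive_T lam).comul_pow, map_sum]
  refine Finset.sum_congr rfl fun m hm => ?_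
  have hmk : m + (k - m) = k := Nat.add_sub_of_le (Nat.lt_succ_iff.1 (Finset.mem_range.1 hm))
  let f : R[X] := Polynomial.X ^ m * (1 + Polynomial.C lam * Polynomial.X) ^ (k - m)
  have hf : f.natDegree ≤ m + (k - m) := by
    unfold f
    compute_degree
  have haeval {A : Type u} [CommRing A] [Algebra R A] (x : A) :
      x ^ m * (1 + lam • x) ^ (k - m) = f.aeval x := by
    simp [f, Algebra.smul_def]
  rw [map_nsmul, TensorProduct.map_tmul, haeval, haeval,
    gammaSection_aeval_T p n lam (by omega), gammaSection_T_pow p n lam (by omega)]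

/-- The section `T ^ s ↦ T ^ s` as a homomorphism of coalgebras. -/
def gammaSectionCoalgHom : GammaAlg p n lam →ₗc[R] GAlg lam where
  __ := gammaSection p n lam
  counit_comp := (GammaAlg.basis p n lam).ext fun s => by
    simp [GammaAlg.basis_apply, gammaSection_T_pow p n lam s.2]
  map_comp_comul := (GammaAlg.basis p n lam).ext fun s => by
    simp only [LinearMap.comp_apply, GammaAlg.basis_apply, gammaSection_T_pow p n lam s.2]
    exact map_gammaSection_comul_T_pow p n lam s.2

theorem GAlg.isCleftExtension : IsCleftExtension (frob p n lam) (toGamma p n lam) where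
  injective := frob_injective p n lam
  range_eq := (frobRange_le_coinvariants p n lam).antisymm
    (coinvariants_le_of_span_eq_top (ψ := gammaSectionCoalgHom p n lam)
      (toGamma_gammaSection p n lam) (frobRange_le_coinvariants p n lam)
      (span_range_gammaSection p n lam))
  exists_section := ⟨gammaSectionCoalgHom p n lam, toGamma_gammaSection p n lam⟩

end Frobenius

namespace UGammaAlg

variable {R : Type u} [CommRing R] (p n : ℕ) [Fact p.Prime] [Algebra (ZMod p) R] (lam : R)

theorem X_eq (s : Fin (p ^ n)) :
    X p n lam s = UAlg.univ (GammaAlg.basis p n lam) (GammaAlg.T p n lam ^ (s : ℕ)) := by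
  rw [X, ← UAlg.univ_basis, GammaAlg.basis_apply]

/-- The homomorphism `X_{T ^ s} ↦ T ^ s` of Hopf algebras, defining `σ₁ : 𝒢^(λ) → U(Γ)`. -/
def toGAlg : UGammaAlg p n lam →ₐc[R] GAlg lam :=
  UAlg.liftCoalgHom (GammaAlg.basis p n lam) (gammaSectionCoalgHom p n lam)

theorem toGAlg_X (s : Fin (p ^ n)) : toGAlg p n lam (X p n lam s) = GAlg.T lam ^ (s : ℕ) := by
  rw [X_eq, toGAlg, UAlg.liftCoalgHom_univ]
  exact gammaSection_T_pow p n lam s.2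

theorem toGamma_comp_toGAlg :
    (GAlg.toGamma p n lam).comp (toGAlg p n lam) = UAlg.toGroup (GammaAlg.basis p n lam) :=
  UAlg.comp_liftCoalgHom _ (toGamma_gammaSection p n lam)

theorem isGroupLikeElem_X_zero (h : 0 < p ^ n) : IsGroupLikeElem R (X p n lam ⟨0, h⟩) := by
  rw [X_eq, pow_zero]
  exact IsGroupLikeElem.one.map (UAlg.univCoalgHom (GammaAlg.basis p n lam))

/-- The homomorphism `T ↦ X_T / X_1` of Hopf algebras, defining `σ₂ : U(Γ) → 𝒢^(λ)`. Since `X_1` is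
group-like, `1 / X_1` is the antipode of `X_1`. -/
def ofGAlg : GAlg lam →ₐc[R] UGammaAlg p n lam :=
  GAlg.liftBialgHom ((GammaAlg.isLamPrimitive_T p n lam).mul_antipode
    (UAlg.univCoalgHom (GammaAlg.basis p n lam)))

theorem ofGAlg_T_mul_X_zero (h₀ : 0 < p ^ n) (h₁ : 1 < p ^ n) :
    ofGAlg p n lam (GAlg.T lam) * X p n lam ⟨0, h₀⟩ = X p n lam ⟨1, h₁⟩ := by
  rw [ofGAlg, GAlg.liftBialgHom_T, X_eq, X_eq, pow_zero, pow_one]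
  exact mul_antipode_one_mul_one (UAlg.univCoalgHom (GammaAlg.basis p n lam)) _

theorem toGroup_comp_ofGAlg :
    (UAlg.toGroup (GammaAlg.basis p n lam)).comp (ofGAlg p n lam) = GAlg.toGamma p n lam :=
  calc (UAlg.toGroup (GammaAlg.basis p n lam)).comp (ofGAlg p n lam)
    _ = GAlg.liftBialgHom (GammaAlg.isLamPrimitive_T p n lam) :=
      comp_liftBialgHom_mul_antipode (UAlg.toGroup_univ (GammaAlg.basis p n lam)) _
    _ = GAlg.toGamma p n lam :=
      GAlg.bialgHom_ext ((GAlg.liftBialgHom_T _).trans (GAlg.toGamma_T p n lam).symm)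

end UGammaAlg

end GrothendieckResolution

end

theorem theorem3p8 {R : Type*} [CommRing R] (p : ℕ) [Fact p.Prime] [Algebra (ZMod p) R]
    (n : ℕ) (hn : 0 < n) (lam : R) :
    -- exactness of the two rows
    ShortExact (eMap p n lam) (frobMap p n lam) ∧
    ShortExact (iMap p n lam) (qMap p n lam) ∧
    -- first diagram
    (∃ s₁ : UGammaAlg p n lam →ₐc[R] GAlg lam,
      (∀ s : Fin (p ^ n), s₁ (UGammaAlg.X p n lam s) = GAlg.T lam ^ (s : ℕ)) ∧
      eMap p n lam ≫ specGrpMap s₁ = iMap p n lam ∧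
      ∃! τ₁ : scriptG (lam ^ p ^ n) ⟶ UModGam p n lam,
        frobMap p n lam ≫ τ₁ = specGrpMap s₁ ≫ qMap p n lam) ∧
    -- second diagram
    (IsUnit (UGammaAlg.X p n lam ⟨0, pow_pos (Fact.out : p.Prime).pos n⟩) ∧
    ∃ s₂ : GAlg lam →ₐc[R] UGammaAlg p n lam,
      s₂ (GAlg.T lam) * UGammaAlg.X p n lam ⟨0, pow_pos (Fact.out : p.Prime).pos n⟩ =
        UGammaAlg.X p n lam ⟨1, Nat.one_lt_pow hn.ne' (Fact.out : p.Prime).one_lt⟩ ∧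
      iMap p n lam ≫ specGrpMap s₂ = eMap p n lam ∧
      ∃! τ₂ : UModGam p n lam ⟶ scriptG (lam ^ p ^ n),
        qMap p n lam ≫ τ₂ = specGrpMap s₂ ≫ frobMap p n lam) := by
  have := Module.Finite.of_basis (GammaAlg.basis p n lam)
  have := Module.Free.of_basis (GammaAlg.basis p n lam)
  have hG := GAlg.isCleftExtension p n lam
  have hU := QAlg.isCleftExtension (GammaAlg.basis p n lam)
  have h₁ := UGammaAlg.toGamma_comp_toGAlg p n lam
  have h₂ := UGammaAlg.toGroup_comp_ofGAlg p n lam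
  refine ⟨hG.shortExact, hU.shortExact, ?_, ?_, ?_⟩
  · exact ⟨UGammaAlg.toGAlg p n lam, UGammaAlg.toGAlg_X p n lam,
      (specGrpMap_comp _ _).trans congr(specGrpMap $h₁), hU.existsUnique_quotientMap hG h₁⟩
  · exact (UGammaAlg.isGroupLikeElem_X_zero p n lam _).isUnit
  · exact ⟨UGammaAlg.ofGAlg p n lam, UGammaAlg.ofGAlg_T_mul_X_zero p n lam _ _,
      (specGrpMap_comp _ _).trans congr(specGrpMap $h₂), hG.existsUnique_quotientMap hU h₂⟩
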